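/- Let $F/\mathbb{F}_q$ be a function field in one variable with full constant field $\mathbb{F}_q$, and let $\sigma\in\mathrm{Aut}(F/\mathbb{F}_q)$ be an automorphism of finite order with fixed field $F^\sigma$. Suppose that there is a rational place $Q$ (a place of degree $1$) of $F^\sigma$ such that exactly one place $Q'$ of $F$ lies above $Q$. Let $D\ge 0$ be a divisor of $F$ with $D^\sigma=D$, $Q'\notin\mathrm{supp}(D)$ and $\ell:=\deg(D)<[F:F^\sigma]$. Let $\mathcal{L}(D)=\{f\in F\setminus\{0\}:(f)+D\ge 0\}\cup\{0\}$ be its Riemann–Roch space. Let $s,t$ be integers with $1\le s\le t$. For a place $P$ of $F$ write $P^{\tau}=\{\tau(f): f\in P\}$ for $\tau\in\mathrm{Aut}(F/\mathbb{F}_q)$, and $S_P=\{P^{\sigma^{-i}}: 0\le i\le t-1\}$. Let $\mathcal{F}_r$ be a set of places $P$ of $F$ of degree $r$ with $P\notin\mathrm{supp}(D)$ and $|S_P|=t$, such that the sets $S_P$ $(P\in\mathcal{F}_r)$ are pairwise disjoint. For $P\in\mathcal{F}_r$ put $$\mathcal{I}_P=\{f\in\mathcal{L}(D): f(P^{\sigma^{-i}})=0\text{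 for each } i\in\{0,\dots,t-1\}\},$$ where $f(R)$ denotes the residue class of $f$ at the place $R$. Then each $\mathcal{I}_P$, $P\in\mathcal{F}_r$, has codimension at most $rt$ in $\mathcal{L}(D)$, and $(\mathcal{I}_P)_{P\in\mathcal{F}_r}$ is an $\left(s,\frac{\ell s}{r(t-s+1)}\right)$-strong subspace design in $\mathcal{L}(D)$: it is a finite collection of subspaces of the finite-dimensional $\mathbb{F}_q$-space $\mathcal{L}(D)$, and every $\mathbb{F}_q$-subspace $W\subseteq\mathcal{L}(D)$ of dimension $s$ satisfies $$\sum_{P\in\mathcal{F}_r}\dim_{\mathbb{F}_q}(W\cap\mathcal{I}_P)\le\frac{\ell s}{r(t-s+1)}.$$ -/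

import Mathlib

open scoped WithZero IntermediateField

noncomputable section

namespace FnField

/-- `F` is a function field (in one variable) over `k`: there is an element `z` of `F` which is
transcendental over `k` such that `F / k(z)` is a finite extension. -/
def IsFunctionField (k F : Type*) [Field k] [Field F] [Algebra k F] : Prop :=
  ∃ z : F, Transcendental k z ∧ FiniteDimensional k⟮z⟯ F

/-- `k` is the full constant field of `F`: the algebraic closure of `k` in `F` is `k` itself. -/
def IsFullConstantField (k F : Type*) [Field k] [Field F] [Algebra k F] : Prop :=
  algebraicClosure k F = ⊥

/-- A place of `F / k`, given by its normalized discrete valuation `ν_P : F → ℤ ∪ {∞}` that is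
trivial on `k`. The valuation is written multiplicatively, so that `valuation f = exp (-ν_P f)`
for `f ≠ 0` and `valuation 0 = 0`; hence `ν_P f ≥ m` reads `valuation f ≤ exp (-m)`. -/
@[ext]
structure Place (k F : Type*) [Field k] [Field F] [Algebra k F] where
  /-- the valuation `exp (-ν_P)` -/
  valuation : Valuation F ℤᵐ⁰
  surjective : Function.Surjective valuation
  map_const_le : ∀ a : k, valuation (algebraMap k F a) ≤ 1

namespace Place

variable {k F : Type*} [Field k] [Field F] [Algebra k F]

/-- The local ring `O_P = {f : ν_P f ≥ 0}` of a place. -/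
def ring (P : Place k F) : ValuationSubring F := P.valuation.valuationSubring

instance (P : Place k F) : Algebra k P.ring :=
  RingHom.toAlgebra ((algebraMap k F).codRestrict P.ring P.map_const_le)

/-- The residue class field `F_P = O_P / P`. -/
abbrev ResidueField (P : Place k F) : Type _ := IsLocalRing.ResidueField P.ring

/-- The degree `deg P = [F_P : k]`. -/
def degree (P : Place k F) : ℕ := Module.finrank k P.ResidueField

/-- `f (P) = 0`: the function `f` lies in the maximal ideal of `O_P`, i.e. `f ∈ O_P` and its
residue class in `F_P` is zero. -/
def Vanishes (P : Place k F) (f : F) : Prop := P.valuation f < 1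

/-- The conjugate place `P^σ = {σ f : f ∈ P}`, i.e. `ν_{P^σ} (f) = ν_P (σ⁻¹ f)`. -/
def conj (σ : F ≃ₐ[k] F) (P : Place k F) : Place k F where
  valuation := P.valuation.comap (σ.symm : F →+* F)
  surjective := fun y => by
    obtain ⟨x, hx⟩ := P.surjective y
    exact ⟨σ x, by simpa using hx⟩
  map_const_le := fun a => by simpa using P.map_const_le a

/-- For an intermediate field `K` of `F / k`, the place `P` of `F` lies above the place `Q` of `K`:
`O_P ∩ K = O_Q`. -/
def LiesAbove {K : IntermediateField k F} (P : Place k F) (Q : Place k K) : Prop :=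
  ∀ x : K, (x : F) ∈ P.ring ↔ x ∈ Q.ring

/-- The orbit segment `S_P = {P, P^{σ⁻¹}, …, P^{σ^{-(t-1)}}}`. -/
def orbitSegment (σ : F ≃ₐ[k] F) (t : ℕ) (P : Place k F) : Set (Place k F) :=
  {R | ∃ i < t, R = P.conj (σ ^ i)⁻¹}

end Place

/-- Divisors of `F / k`: formal integer combinations of places. -/
abbrev Divisor (k F : Type*) [Field k] [Field F] [Algebra k F] : Type _ := Place k F →₀ ℤ

namespace Divisor

variable {k F : Type*} [Field k] [Field F] [Algebra k F]

/-- `deg (∑ m_P P) = ∑ m_P deg P`. -/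
def degree (D : Divisor k F) : ℤ := D.sum fun P m => m * (P.degree : ℤ)

/-- The conjugate divisor `(∑ m_P P)^σ = ∑ m_P P^σ`. -/
def conj (σ : F ≃ₐ[k] F) (D : Divisor k F) : Divisor k F := Finsupp.mapDomain (Place.conj σ) D

/-- The Riemann-Roch space `L(D) = {f ≠ 0 : (f) + D ≥ 0} ∪ {0}`, i.e. the set of all `f` such that
`ν_P f ≥ - D P` for all places `P`. -/
def riemannRoch (D : Divisor k F) : Submodule k F where
  carrier := {f | ∀ P : Place k F, P.valuation f ≤ WithZero.exp (D P)}
  zero_mem' := fun P => by simp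
  add_mem' := fun {f g} hf hg P => (P.valuation.map_add f g).trans (max_le (hf P) (hg P))
  smul_mem' := fun a f hf P => by
    rw [Algebra.smul_def, map_mul]
    exact (mul_le_mul' (P.map_const_le a) (hf P)).trans (one_mul _).le

/-- The subspace `I_P = {f ∈ L(D) : f (P^{σ^{-i}}) = 0 for i = 0, …, t - 1}` of `L(D)`. -/
def vanishingSubspace (D : Divisor k F) (σ : F ≃ₐ[k] F) (t : ℕ) (P : Place k F) :
    Submodule k D.riemannRoch where
  carrier := {f | ∀ i < t, (P.conj (σ ^ i)⁻¹).Vanishes (f : F)}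
  zero_mem' := fun i _ => by simp [Place.Vanishes]
  add_mem' := fun {f g} hf hg i hi => Valuation.map_add_lt _ (hf i hi) (hg i hi)
  smul_mem' := fun a f hf i hi => by
    have h1 := (P.conj (σ ^ i)⁻¹).map_const_le a
    have h2 : (P.conj (σ ^ i)⁻¹).valuation (f : F) < 1 := hf i hi
    change (P.conj (σ ^ i)⁻¹).valuation (a • (f : F)) < 1
    rw [Algebra.smul_def, map_mul]
    exact (mul_le_of_le_one_left' h1).trans_lt h2

end Divisor

/-- A finite collection `(H_i)` of subspaces of a finite-dimensional `k`-vector space `V` is an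
`(s, L)`-strong subspace design if `∑_i dim (W ∩ H_i) ≤ L` for every `s`-dimensional subspace
`W` of `V`. -/
structure IsStrongSubspaceDesign {k V ι : Type*} [Field k] [AddCommGroup V] [Module k V]
    (H : ι → Submodule k V) (s : ℕ) (L : ℝ) : Prop where
  finite_index : Finite ι
  finiteDimensional : FiniteDimensional k V
  sum_finrank_le : ∀ W : Submodule k V, Module.finrank k W = s →
    ∑ᶠ i, (Module.finrank k ↥(W ⊓ H i) : ℝ) ≤ L

end FnField

end

/-! Fix `W` of dimension `s` with basis `f_1, …, f_s`, and let `Δ = det (σ^j f_i)`, `0 ≤ j < s`, be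
its Casorati determinant. As `D` is `σ`-invariant, the poles of `Δ` are bounded by `sD`. If `f ∈
I_P` and `0 ≤ i ≤ t - s`, then every `σ^j f` vanishes at `P^{σ^{-i}}`, because `i + j < t`. A basis
of `W` adapted to `W ∩ I_P` therefore shows that `Δ` vanishes to order at least `dim (W ∩ I_P)` at
each of these `t - s + 1` places. For all `P` together they are distinct and of degree `r`, so if `Δ
≠ 0`, comparing zeros with poles gives `∑ dim (W ∩ I_P) · r (t - s + 1) ≤ s ℓ`
(`sum_finrank_mul_le`).

`Δ ≠ 0` holds once the `f_i` are independent over `K = F^σ` (`det_casoratiMatrix_ne_zero`). To see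
this independence (`LiesAbove.linearIndependent_of_boundedSpace`), scale a `K`-relation to be
integral at `Q` with a coefficient `1`, and reduce modulo `Q`. As `Q` is rational, this yields a
nontrivial constant combination of the `f_i` divisible at `Q'` by a uniformizer of `Q`, that is,
vanishing to order at least `e`, the ramification index. Uniqueness of `Q'` gives `e deg Q' ≥ [F :
K] > deg D`, too many zeros for a nonzero element of `L(D)`; so the combination is `0`, against
independence over `k`.

Zeros and poles of a transcendental `g` are compared through `[F : k(g)]`: it bounds the degree of
the zeros (`sum_zeros_le`) and is bounded by the degree of the poles (`finrank_adjoin_le`). -/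

namespace FnField

/-! ### Relative lengths of subspaces -/

section RelLength

variable {k V : Type*} [Field k] [AddCommGroup V] [Module k V]

/-- The length (possibly infinite) of the quotient `B / (A ⊓ B)` of two subspaces. -/
noncomputable def relLength (A B : Submodule k V) : ℕ∞ := Module.length k (B ⧸ A.submoduleOf B)

theorem relLength_self (A : Submodule k V) : relLength A A = 0 := by
  rw [relLength, Submodule.submoduleOf_self, Module.length_eq_zero_iff]
  infer_instance

theorem relLength_add {A B C : Submodule k V} (hAB : A ≤ B) (hBC : B ≤ C) :
    relLength A C = relLength A B + relLength B C := by
  let f : (B ⧸ A.submoduleOf B) →ₗ[k] (C ⧸ A.submoduleOf C) :=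
    Submodule.mapQ _ _ (Submodule.inclusion hBC) (fun x hx => hx)
  let g : (C ⧸ A.submoduleOf C) →ₗ[k] (C ⧸ B.submoduleOf C) :=
    Submodule.mapQ _ _ LinearMap.id (fun x hx => hAB hx)
  refine Module.length_eq_add_of_exact f g ?_ ?_ ?_
  · rw [← LinearMap.ker_eq_bot, Submodule.eq_bot_iff]
    intro x hx
    obtain ⟨x, rfl⟩ := Submodule.Quotient.mk_surjective _ x
    have hx' : (x : V) ∈ A :=
      (Submodule.Quotient.mk_eq_zero (A.submoduleOf C) (x := Submodule.inclusion hBC x)).1 hx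
    exact (Submodule.Quotient.mk_eq_zero _).2 hx'
  · intro x
    obtain ⟨x, rfl⟩ := Submodule.Quotient.mk_surjective _ x
    exact ⟨Submodule.Quotient.mk x, rfl⟩
  · intro x
    obtain ⟨x, rfl⟩ := Submodule.Quotient.mk_surjective _ x
    constructor
    · intro hx
      have hx' : (x : V) ∈ B := (Submodule.Quotient.mk_eq_zero (B.submoduleOf C)).1 hx
      exact ⟨Submodule.Quotient.mk ⟨x, hx'⟩, rfl⟩
    · rintro ⟨y, hy⟩
      obtain ⟨y, rfl⟩ := Submodule.Quotient.mk_surjective _ y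
      rw [← hy]
      exact (Submodule.Quotient.mk_eq_zero _).2 y.2

theorem relLength_le_of_ker_le {M : Type*} [AddCommGroup M] [Module k M] {A B : Submodule k V}
    (f : B →ₗ[k] M) (hf : LinearMap.ker f ≤ A.submoduleOf B) :
    relLength A B ≤ Module.length k M :=
  calc relLength A B ≤ Module.length k (B ⧸ LinearMap.ker f) :=
        Module.length_le_of_surjective
          (Submodule.mapQ (LinearMap.ker f) (A.submoduleOf B) LinearMap.id (fun _ hx => hf hx))
          (fun x => by
            obtain ⟨x, rfl⟩ := Submodule.Quotient.mk_surjective _ x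
            exact ⟨Submodule.Quotient.mk x, rfl⟩)
    _ ≤ Module.length k M :=
        Module.length_le_of_injective ((LinearMap.ker f).liftQ f le_rfl)
          (LinearMap.ker_eq_bot.1 (Submodule.ker_liftQ_eq_bot _ _ _ le_rfl))

theorem length_le_relLength_of_surjective {M : Type*} [AddCommGroup M] [Module k M]
    {A B : Submodule k V} (f : B →ₗ[k] M) (hf : A.submoduleOf B ≤ LinearMap.ker f)
    (hs : Function.Surjective f) : Module.length k M ≤ relLength A B :=
  Module.length_le_of_surjective ((A.submoduleOf B).liftQ f hf) (fun y => by
    obtain ⟨x, rfl⟩ := hs y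
    exact ⟨Submodule.Quotient.mk x, rfl⟩)

theorem length_le_of_forall_linearIndependent {M : Type*} [AddCommGroup M] [Module k M] {n : ℕ}
    (h : ∀ s : Finset M, LinearIndependent k (fun i : s => (i : M)) → s.card ≤ n) :
    Module.length k M ≤ n := by
  have h1 : Module.rank k M ≤ n := rank_le h
  have : Module.Finite k M := by
    rw [← Module.rank_lt_aleph0_iff]
    exact h1.trans_lt (Cardinal.natCast_lt_aleph0)
  rw [Module.length_eq_finrank]
  exact_mod_cast Module.finrank_le_of_rank_le h1

theorem relLength_bot (B : Submodule k V) : relLength ⊥ B = Module.length k B :=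
  le_antisymm (relLength_le_of_ker_le (LinearMap.id : B →ₗ[k] B) (by simp))
    (length_le_relLength_of_surjective (LinearMap.id : B →ₗ[k] B)
      (fun x hx => Subtype.ext hx) Function.surjective_id)

theorem finite_of_length_ne_top {M : Type*} [AddCommGroup M] [Module k M]
    (h : Module.length k M ≠ ⊤) : Module.Finite k M := by
  rw [Module.length_ne_top_iff, isFiniteLength_iff_isNoetherian_isArtinian] at h
  have := h.1
  infer_instance

end RelLength

/-! ### Places as absolute values and weak approximation -/

variable {k F : Type*} [Field k] [Field F] [Algebra k F]

theorem lt_exp_iff {x : ℤᵐ⁰} {n : ℤ} : x < WithZero.exp n ↔ x ≤ WithZero.exp (n - 1) := by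
  rw [← WithZero.lt_mul_exp_iff_le WithZero.exp_ne_zero, ← WithZero.exp_add, sub_add_cancel]

namespace Place

theorem exists_valuation_eq_exp (P : Place k F) (n : ℤ) : ∃ y : F, P.valuation y = WithZero.exp n :=
  P.surjective _

theorem ne_zero_of_valuation_eq_exp {P : Place k F} {y : F} {n : ℤ}
    (h : P.valuation y = WithZero.exp n) : y ≠ 0 := by
  rintro rfl
  rw [map_zero] at h
  exact WithZero.exp_ne_zero h.symm

theorem valuation_algebraMap (P : Place k F) {a : k} (ha : a ≠ 0) :
    P.valuation (algebraMap k F a) = 1 := by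
  refine le_antisymm (P.map_const_le a) ?_
  have h := P.map_const_le a⁻¹
  rw [map_inv₀, map_inv₀] at h
  have h0 : P.valuation (algebraMap k F a) ≠ 0 := by simpa using ha
  exact (inv_le_one₀ (zero_lt_iff.2 h0)).1 h

theorem mem_ring_iff (P : Place k F) (f : F) : f ∈ P.ring ↔ P.valuation f ≤ 1 :=
  Valuation.mem_valuationSubring_iff _ _

/-- The maximal ideal determines the units, and every nonzero element is a unit times a power of a
uniformizer `p` of `P`; so the valuation of `R` is governed by its value at `p`, which surjectivity
forces to be `exp (-1)`. -/
theorem ext_of_lt_one_iff {P R : Place k F} (h : ∀ x, P.valuation x < 1 ↔ R.valuation x < 1) :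
    P = R := by
  have h1 : ∀ x, P.valuation x = 1 → R.valuation x = 1 := by
    intro x hx
    refine le_antisymm ?_ (not_lt.1 fun h' => ((h x).2 h').ne hx)
    by_contra hlt
    have : R.valuation x⁻¹ < 1 := by
      rw [map_inv₀]
      exact inv_lt_one_of_one_lt₀ (not_le.1 hlt)
    have := (h _).2 this
    simp [hx] at this
  obtain ⟨p, hp⟩ := P.exists_valuation_eq_exp (-1)
  have key : ∀ x, x ≠ 0 → R.valuation x = R.valuation p ^ (-WithZero.log (P.valuation x)) := by
    intro x hx
    have hx0 : P.valuation x ≠ 0 := by simpa using hx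
    have hp0 := ne_zero_of_valuation_eq_exp hp
    have h2 : P.valuation (x * p ^ (WithZero.log (P.valuation x))) = 1 := by
      rw [map_mul, map_zpow₀, hp, ← WithZero.exp_zsmul]
      nth_rewrite 1 [← WithZero.exp_log hx0]
      rw [← WithZero.exp_add]
      simp
    have h3 := h1 _ h2
    rw [map_mul, map_zpow₀] at h3
    rw [zpow_neg]
    exact eq_inv_of_mul_eq_one_left h3
  have hRp : R.valuation p = WithZero.exp (-1) := by
    have hlt : R.valuation p < WithZero.exp 0 := by
      rw [WithZero.exp_zero, ← h, hp, ← WithZero.exp_zero, WithZero.exp_lt_exp]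
      simp
    rw [lt_exp_iff] at hlt
    refine le_antisymm hlt ?_
    obtain ⟨q, hq⟩ := R.exists_valuation_eq_exp (-1)
    have hq0 := ne_zero_of_valuation_eq_exp hq
    have hk := key q hq0
    have hqP : P.valuation q < WithZero.exp 0 := by
      rw [WithZero.exp_zero, h, hq, ← WithZero.exp_zero, WithZero.exp_lt_exp]
      simp
    have hlog : 1 ≤ -WithZero.log (P.valuation q) := by
      rw [← WithZero.log_lt_iff_lt_exp (by simpa using hq0)] at hqP
      omega
    rw [← hq, hk]
    have h1' : R.valuation p ≤ 1 := hlt.trans (by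
      rw [← WithZero.exp_zero, WithZero.exp_le_exp]; simp)
    obtain ⟨m, hm⟩ := Int.eq_ofNat_of_zero_le (show 0 ≤ -WithZero.log (P.valuation q) by omega)
    rw [hm, zpow_natCast]
    exact pow_le_of_le_one zero_le h1' (by omega)
  refine Place.ext (Valuation.ext fun x => ?_)
  rcases eq_or_ne x 0 with rfl | hx
  · simp
  · rw [key x hx, hRp, ← WithZero.exp_zsmul]
    have hx0 : P.valuation x ≠ 0 := by simpa using hx
    nth_rewrite 1 [← WithZero.exp_log hx0]
    simp

/-- The real absolute value attached to a place. -/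
noncomputable def absoluteValue (P : Place k F) : AbsoluteValue F ℝ where
  toFun x := (WithZeroMulInt.toNNReal (e := 2) two_ne_zero (P.valuation x) : ℝ)
  map_mul' x y := by simp
  nonneg' x := NNReal.coe_nonneg _
  eq_zero' x := by simp
  add_le' x y := by
    have h := (WithZeroMulInt.toNNReal_strictMono (e := 2) one_lt_two).monotone
      (P.valuation.map_add x y)
    rw [(WithZeroMulInt.toNNReal_strictMono (e := 2) one_lt_two).monotone.map_max] at h
    exact_mod_cast h.trans (max_le_add_of_nonneg zero_le zero_le)

theorem absoluteValue_lt_iff (P : Place k F) (x y : F) :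
    P.absoluteValue x < P.absoluteValue y ↔ P.valuation x < P.valuation y := by
  change ((_ : NNReal) : ℝ) < ((_ : NNReal) : ℝ) ↔ _
  rw [NNReal.coe_lt_coe]
  exact (WithZeroMulInt.toNNReal_strictMono (e := 2) one_lt_two).lt_iff_lt

/-- Weak approximation: finitely many places, arbitrary targets. -/
theorem exists_forall_valuation_sub_le (S : Finset (Place k F)) (y : Place k F → F)
    (m : Place k F → ℤ) : ∃ f : F, ∀ P ∈ S, P.valuation (f - y P) ≤ WithZero.exp (m P) := by
  have hnt : ∀ P : S, (P : Place k F).absoluteValue.IsNontrivial := by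
    intro P
    obtain ⟨p, hp⟩ := (P : Place k F).exists_valuation_eq_exp (-1)
    refine ⟨p, ne_zero_of_valuation_eq_exp hp, fun h => ?_⟩
    have := (absoluteValue_lt_iff (P : Place k F) p 1).2 (by
      rw [hp, map_one, ← WithZero.exp_zero, WithZero.exp_lt_exp]; simp)
    rw [h, map_one] at this
    exact lt_irrefl _ this
  have hpw : Pairwise fun P R : S =>
      ¬ (P : Place k F).absoluteValue.IsEquiv (R : Place k F).absoluteValue := by
    intro P R hPR h
    refine hPR (Subtype.ext (ext_of_lt_one_iff fun x => ?_))
    have := AbsoluteValue.isEquiv_iff_lt_one_iff.1 h x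
    rw [← map_one (P : Place k F).absoluteValue, absoluteValue_lt_iff,
      map_one (P : Place k F).absoluteValue, ← map_one (R : Place k F).absoluteValue,
      absoluteValue_lt_iff] at this
    simpa using this
  choose b hb using fun P : Place k F => P.exists_valuation_eq_exp (m P)
  have hbpos : ∀ P : Place k F, 0 < P.absoluteValue (b P) := by
    intro P
    exact P.absoluteValue.pos (ne_zero_of_valuation_eq_exp (hb P))
  obtain ⟨r, hr0, hr⟩ : ∃ r : ℝ, 0 < r ∧ ∀ P : S, r ≤ (P : Place k F).absoluteValue (b P) := by
    rcases isEmpty_or_nonempty S with hS | hS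
    · exact ⟨1, one_pos, fun P => hS.elim P⟩
    · obtain ⟨P, hP⟩ := Finite.exists_min fun P : S => (P : Place k F).absoluteValue (b P)
      exact ⟨_, hbpos P, hP⟩
  obtain ⟨f, hf⟩ := Metric.denseRange_iff.1
    (AbsoluteValue.denseRange_algebraMap_pi hnt hpw)
    (fun P => WithAbs.toAbs _ (y P)) r hr0
  refine ⟨f, fun P hP => ?_⟩
  have h1 := (dist_pi_lt_iff hr0).1 hf ⟨P, hP⟩
  rw [dist_comm, dist_eq_norm] at h1
  have h2 : P.absoluteValue (f - y P) < P.absoluteValue (b P) := h1.trans_le (hr ⟨P, hP⟩)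
  rw [absoluteValue_lt_iff, hb] at h2
  exact h2.le

end Place
-- Finiteness of `F` over `k(x)` and the dimension of `B / xB`
open scoped IntermediateField.algebraAdjoinAdjoin in
theorem IsFunctionField.isAlgebraic_adjoin (hF : IsFunctionField k F) {x : F}
    (hx : Transcendental k x) : Algebra.IsAlgebraic k⟮x⟯ F := by
  obtain ⟨z, hz, hfin⟩ := hF
  have hzi : AlgebraicIndependent k (fun _ : Unit => z) :=
    algebraicIndependent_unique_type_iff.2 hz
  have hxi : AlgebraicIndependent k (fun _ : Unit => x) :=
    algebraicIndependent_unique_type_iff.2 hx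
  have halg : Algebra.IsAlgebraic (Algebra.adjoin k {z}) F :=
    Algebra.IsAlgebraic.trans (Algebra.adjoin k {z}) k⟮z⟯ F
  have hzb : IsTranscendenceBasis k (fun _ : Unit => z) := by
    rw [hzi.isTranscendenceBasis_iff_isAlgebraic, Set.range_const]
    exact halg
  have hxb : IsTranscendenceBasis k (fun _ : Unit => x) :=
    hxi.isTranscendenceBasis_of_lift_trdeg_le_of_finite (by
      rw [← hzb.lift_cardinalMk_eq_trdeg])
  have := hxb.isAlgebraic
  rw [Set.range_const] at this
  exact Algebra.IsAlgebraic.extendScalars (R := Algebra.adjoin k {x}) (S := k⟮x⟯)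
    (FaithfulSMul.algebraMap_injective _ _)

/-- `F` is finitely generated as a field over `k`, hence over `k(x)`, where it is also algebraic. -/
theorem IsFunctionField.finiteDimensional_adjoin (hF : IsFunctionField k F) {x : F}
    (hx : Transcendental k x) : FiniteDimensional k⟮x⟯ F := by
  have halg := hF.isAlgebraic_adjoin hx
  obtain ⟨z, hz, hfin⟩ := hF
  have hz2 : Algebra.EssFiniteType k k⟮z⟯ :=
    IntermediateField.essFiniteType_iff.2 ⟨{z}, by simp⟩
  have hz3 : Algebra.EssFiniteType k F := .comp k k⟮z⟯ F
  have hz4 : Algebra.EssFiniteType k⟮x⟯ F := .of_comp k k⟮x⟯ F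
  obtain ⟨s, hs⟩ := IntermediateField.fg_top (F := k⟮x⟯) (E := F)
  have hE : FiniteDimensional k⟮x⟯ (IntermediateField.adjoin k⟮x⟯ (s : Set F)) :=
    IntermediateField.finiteDimensional_adjoin fun y _ => (halg.isAlgebraic y).isIntegral
  rw [hs] at hE
  exact Module.Finite.equiv (IntermediateField.topEquiv (F := k⟮x⟯) (E := F)).toLinearEquiv

open Polynomial in
/-- A family in an `x`-stable subspace `B` that is linearly independent over `k` modulo `x B`
satisfies no polynomial relation in `x`. -/
theorem eq_zero_of_sum_aeval_mul_eq_zero {ι : Type*} [Fintype ι] {x : F} (hx : x ≠ 0)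
    {B : Submodule k F} (hB : ∀ f ∈ B, x * f ∈ B) {w : ι → F} (hw : ∀ i, w i ∈ B)
    (hind : ∀ c : ι → k, (∃ b ∈ B, ∑ i, c i • w i = x * b) → c = 0) :
    ∀ (n : ℕ) (p : ι → k[X]), (∀ i, (p i).natDegree ≤ n) → ∑ i, aeval x (p i) * w i = 0 →
      p = 0 := by
  have hBp : ∀ (q : k[X]) (f : F), f ∈ B → aeval x q * f ∈ B := by
    intro q f hf
    induction q using Polynomial.induction_on' with
    | add p q hp hq => rw [map_add, add_mul]; exact add_mem hp hq
    | monomial n a =>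
      rw [aeval_monomial, mul_assoc, ← Algebra.smul_def]
      refine B.smul_mem _ ?_
      induction n with
      | zero => simpa
      | succ n ih => rw [pow_succ', mul_assoc]; exact hB _ ih
  -- Modulo `xB` only the constant terms of a relation survive, so they vanish; dividing by `x`
  -- leaves a relation of smaller degree.
  have step : ∀ p : ι → k[X], ∑ i, aeval x (p i) * w i = 0 →
      (∀ i, (p i).coeff 0 = 0) ∧ ∑ i, aeval x (p i).divX * w i = 0 := by
    intro p hp
    have h1 : ∀ i, aeval x (p i) * w i =
        (p i).coeff 0 • w i + x * (aeval x (p i).divX * w i) := by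
      intro i
      conv_lhs => rw [← Polynomial.X_mul_divX_add (p i)]
      rw [map_add, map_mul, aeval_X, aeval_C, Algebra.smul_def]
      ring
    simp_rw [h1, Finset.sum_add_distrib, ← Finset.mul_sum] at hp
    have h2 := hind (fun i => (p i).coeff 0)
      ⟨-∑ i, aeval x (p i).divX * w i, neg_mem (sum_mem fun i _ => hBp _ _ (hw i)), by
        rw [mul_neg]; exact eq_neg_of_add_eq_zero_left hp⟩
    have h3 : ∀ i, (p i).coeff 0 = 0 := congrFun h2
    refine ⟨h3, ?_⟩
    simp_rw [h3, zero_smul, Finset.sum_const_zero, zero_add] at hp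
    exact (mul_eq_zero.1 hp).resolve_left hx
  intro n
  induction n with
  | zero =>
    intro p hdeg hp
    obtain ⟨h1, -⟩ := step p hp
    ext1 i
    rw [Polynomial.eq_C_of_natDegree_le_zero (hdeg i), h1 i]
    simp
  | succ n ih =>
    intro p hdeg hp
    obtain ⟨h1, h2⟩ := step p hp
    have h3 := ih _ (fun i => by
      rw [Polynomial.natDegree_divX_eq_natDegree_tsub_one]
      have := hdeg i
      omega) h2
    ext1 i
    have h4 : (p i).divX = 0 := congrFun h3 i
    rw [← Polynomial.X_mul_divX_add (p i), h4, h1 i]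
    simp

open scoped IntermediateField.algebraAdjoinAdjoin in
theorem linearIndependent_adjoin_of_modulo {ι : Type*} [Fintype ι] {x : F} (hx : x ≠ 0)
    {B : Submodule k F} (hB : ∀ f ∈ B, x * f ∈ B) {w : ι → F} (hw : ∀ i, w i ∈ B)
    (hind : ∀ c : ι → k, (∃ b ∈ B, ∑ i, c i • w i = x * b) → c = 0) :
    LinearIndependent k⟮x⟯ w := by
  rw [← LinearIndependent.iff_fractionRing (Algebra.adjoin k {x}) k⟮x⟯,
    Fintype.linearIndependent_iff]
  intro g hg
  have hg' : ∀ i, ∃ p : Polynomial k, Polynomial.aeval x p = (g i : F) := by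
    intro i
    have := (g i).2
    exact (Algebra.adjoin_singleton_eq_range_aeval k x).le this
  choose p hp using hg'
  have h0 := eq_zero_of_sum_aeval_mul_eq_zero hx hB hw hind
    (Finset.univ.sup fun i => (p i).natDegree) p
    (fun i => Finset.le_sup (f := fun i => (p i).natDegree) (Finset.mem_univ i)) (by
      simp_rw [hp]
      exact hg)
  intro i
  apply Subtype.ext
  rw [← hp i, h0]
  simp

/-- For an `x`-stable subspace `B` the dimension of `B / x B` is at most `[F : k(x)]`. -/
theorem relLength_le_finrank_adjoin (hF : IsFunctionField k F) {x : F}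
    (hx : Transcendental k x) {A B : Submodule k F}
    (hB : ∀ f ∈ B, x * f ∈ B) (hA : ∀ f ∈ B, x * f ∈ A) :
    relLength A B ≤ Module.finrank k⟮x⟯ F := by
  have := hF.finiteDimensional_adjoin hx
  have hx0 : x ≠ 0 := by
    rintro rfl
    exact hx isAlgebraic_zero
  refine length_le_of_forall_linearIndependent fun s hs => ?_
  choose w hw using fun v : B ⧸ A.submoduleOf B => Submodule.Quotient.mk_surjective _ v
  have hl := linearIndependent_adjoin_of_modulo (ι := s) (w := fun i => (w i : F)) hx0 hB
    (fun i => (w i).2) (fun c => by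
      rintro ⟨b, hb, h⟩
      have h1 : ∑ i : s, c i • (i : B ⧸ A.submoduleOf B) = 0 := by
        have h2 : (∑ i : s, c i • w i : B) ∈ A.submoduleOf B := by
          change ((∑ i : s, c i • w i : B) : F) ∈ A
          rw [Submodule.coe_sum]
          simp only [Submodule.coe_smul]
          rw [h]
          exact hA b hb
        rw [← Submodule.Quotient.mk_eq_zero, ← Submodule.mkQ_apply, map_sum] at h2
        simpa only [map_smul, Submodule.mkQ_apply, hw] using h2
      exact funext (Fintype.linearIndependent_iff.1 hs c h1))
  simpa using hl.fintype_card_le_finrank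

/-! ### Residue fields and leading coefficients -/

namespace Place

/-- The valuation ring contains `k` and is integrally closed. -/
theorem valuation_le_one_of_isAlgebraic (P : Place k F) {f : F} (hf : IsAlgebraic k f) :
    P.valuation f ≤ 1 := by
  have h1 : IsIntegral P.ring f := by
    obtain ⟨p, hp, hpf⟩ := hf.isIntegral
    refine ⟨p.map (algebraMap k P.ring), hp.map _, ?_⟩
    rw [Polynomial.eval₂_map]
    exact hpf
  obtain ⟨y, hy⟩ := IsIntegrallyClosed.isIntegral_iff.1 h1
  rw [← mem_ring_iff, ← hy]
  exact y.2

theorem valuation_eq_one_of_isAlgebraic (P : Place k F) {f : F} (hf : IsAlgebraic k f)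
    (h0 : f ≠ 0) : P.valuation f = 1 := by
  refine le_antisymm (P.valuation_le_one_of_isAlgebraic hf) ?_
  have h := P.valuation_le_one_of_isAlgebraic hf.inv
  rw [map_inv₀] at h
  exact (inv_le_one₀ (zero_lt_iff.2 (by simpa using h0))).1 h

theorem transcendental_of_valuation_lt_one {P : Place k F} {f : F} (hf : P.valuation f < 1)
    (h0 : f ≠ 0) : Transcendental k f :=
  fun h => hf.ne (P.valuation_eq_one_of_isAlgebraic h h0)

/-- The leading coefficient map: if all elements of `B` have valuation at most that of `y ≠ 0`, it
sends `f` to the residue class of `f / y`. -/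
noncomputable def leadingCoeff (P : Place k F) (y : F) (B : Submodule k F)
    (hB : ∀ f ∈ B, P.valuation (f / y) ≤ 1) : B →ₗ[k] P.ResidueField where
  toFun f := IsLocalRing.residue P.ring ⟨(f : F) / y, (P.mem_ring_iff _).2 (hB f f.2)⟩
  map_add' f g := by
    rw [← map_add]
    congr 1
    exact Subtype.ext (add_div _ _ _)
  map_smul' a f := by
    rw [RingHom.id_apply, Algebra.smul_def, IsScalarTower.algebraMap_apply k P.ring P.ResidueField,
      IsLocalRing.ResidueField.algebraMap_eq, ← map_mul]
    congr 1
    apply Subtype.ext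
    change (a • (f : F)) / y = algebraMap k F a * (f / y)
    rw [Algebra.smul_def, mul_div_assoc]

theorem leadingCoeff_eq_zero_iff (P : Place k F) {y : F} {B : Submodule k F}
    {hB : ∀ f ∈ B, P.valuation (f / y) ≤ 1} (f : B) :
    P.leadingCoeff y B hB f = 0 ↔ P.valuation ((f : F) / y) < 1 := by
  change IsLocalRing.residue P.ring _ = 0 ↔ _
  rw [IsLocalRing.residue_eq_zero_iff, ValuationSubring.valuation_lt_one_iff]
  exact (Valuation.isEquiv_valuation_valuationSubring P.valuation).lt_one_iff_lt_one.symm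

theorem valuation_div_le_one_iff {P : Place k F} {f y : F} {n : ℤ}
    (hy : P.valuation y = WithZero.exp n) :
    P.valuation (f / y) ≤ 1 ↔ P.valuation f ≤ WithZero.exp n := by
  rw [map_div₀, hy, div_le_one₀ WithZero.exp_pos]

theorem valuation_div_lt_one_iff {P : Place k F} {f y : F} {n : ℤ}
    (hy : P.valuation y = WithZero.exp n) :
    P.valuation (f / y) < 1 ↔ P.valuation f ≤ WithZero.exp (n - 1) := by
  rw [map_div₀, hy, div_lt_one₀ WithZero.exp_pos, lt_exp_iff]

theorem relLength_le_length_residueField (P : Place k F) (n : ℤ) {A B : Submodule k F}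
    (hB : ∀ f ∈ B, P.valuation f ≤ WithZero.exp n)
    (hA : ∀ f ∈ B, P.valuation f ≤ WithZero.exp (n - 1) → f ∈ A) :
    relLength A B ≤ Module.length k P.ResidueField := by
  obtain ⟨y, hy⟩ := P.exists_valuation_eq_exp n
  refine relLength_le_of_ker_le
    (P.leadingCoeff y B fun f hf => (valuation_div_le_one_iff hy).2 (hB f hf)) fun f hf => ?_
  rw [LinearMap.mem_ker, leadingCoeff_eq_zero_iff, valuation_div_lt_one_iff hy] at hf
  exact hA f f.2 hf

theorem length_residueField_le_relLength (P : Place k F) (n : ℤ) {A B : Submodule k F}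
    (hB : ∀ f ∈ B, P.valuation f ≤ WithZero.exp n)
    (hA : ∀ f ∈ B, f ∈ A → P.valuation f ≤ WithZero.exp (n - 1))
    (hs : ∀ g, P.valuation g ≤ WithZero.exp n →
      ∃ f ∈ B, P.valuation (f - g) ≤ WithZero.exp (n - 1)) :
    Module.length k P.ResidueField ≤ relLength A B := by
  obtain ⟨y, hy⟩ := P.exists_valuation_eq_exp n
  have hy0 := ne_zero_of_valuation_eq_exp hy
  refine length_le_relLength_of_surjective
    (P.leadingCoeff y B fun f hf => (valuation_div_le_one_iff hy).2 (hB f hf)) (fun f hf => ?_) ?_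
  · rw [LinearMap.mem_ker, leadingCoeff_eq_zero_iff, valuation_div_lt_one_iff hy]
    exact hA f f.2 hf
  · intro c
    obtain ⟨c, rfl⟩ := IsLocalRing.residue_surjective c
    have hc : P.valuation (c * y : F) ≤ WithZero.exp n := by
      rw [map_mul, hy]
      exact mul_le_of_le_one_left' ((P.mem_ring_iff _).1 c.2)
    obtain ⟨f, hf, hfg⟩ := hs _ hc
    refine ⟨⟨f, hf⟩, ?_⟩
    rw [← sub_eq_zero]
    change IsLocalRing.residue P.ring _ - _ = 0
    rw [← map_sub, IsLocalRing.residue_eq_zero_iff, ValuationSubring.valuation_lt_one_iff]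
    refine (Valuation.isEquiv_valuation_valuationSubring P.valuation).lt_one_iff_lt_one.1 ?_
    rw [← valuation_div_lt_one_iff hy] at hfg
    convert hfg using 2
    change f / y - c = _
    field_simp

end Place

/-! ### Spaces of functions with bounded poles; the degree of the zeros -/

/-- The space of all functions whose pole order at each place `P ∈ S` is at most `A P`. -/
def boundedSpace (S : Set (Place k F)) (A : Place k F → ℤ) : Submodule k F where
  carrier := {f | ∀ P ∈ S, P.valuation f ≤ WithZero.exp (A P)}
  zero_mem' := fun P _ => by simp
  add_mem' := fun {f g} hf hg P hP => (P.valuation.map_add f g).trans (max_le (hf P hP) (hg P hP))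
  smul_mem' := fun a f hf P hP => by
    rw [Algebra.smul_def, map_mul]
    exact (mul_le_mul' (P.map_const_le a) (hf P hP)).trans (one_mul _).le

theorem mem_boundedSpace {S : Set (Place k F)} {A : Place k F → ℤ} {f : F} :
    f ∈ boundedSpace S A ↔ ∀ P ∈ S, P.valuation f ≤ WithZero.exp (A P) := Iff.rfl

theorem boundedSpace_mono {S : Set (Place k F)} {A B : Place k F → ℤ} (h : ∀ P ∈ S, A P ≤ B P) :
    boundedSpace S A ≤ boundedSpace S B :=
  fun _ hf P hP => (hf P hP).trans (WithZero.exp_le_exp.2 (h P hP))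

/-- The residue field is `B / xB` for `B = O_P` and a uniformizer `x`, which is transcendental; its
dimension is thus at most `[F : k(x)]`. -/
theorem IsFunctionField.finite_residueField (hF : IsFunctionField k F) (P : Place k F) :
    Module.Finite k P.ResidueField := by
  obtain ⟨x, hx⟩ := P.exists_valuation_eq_exp (-1)
  have hx0 := Place.ne_zero_of_valuation_eq_exp hx
  have hxt : Transcendental k x := Place.transcendental_of_valuation_lt_one (P := P) (by
    rw [hx, ← WithZero.exp_zero, WithZero.exp_lt_exp]; simp) hx0
  have hmul : ∀ f ∈ boundedSpace {P} (fun _ : Place k F => (0 : ℤ)),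
      x * f ∈ boundedSpace {P} (fun _ : Place k F => (-1 : ℤ)) := by
    rintro f hf R rfl
    rw [map_mul, hx]
    simpa using mul_le_mul_right (hf R rfl) (WithZero.exp (-1))
  refine finite_of_length_ne_top (ne_top_of_le_ne_top (ENat.natCast_ne_top _)
    ((P.length_residueField_le_relLength (A := boundedSpace {P} fun _ => -1)
      (B := boundedSpace {P} fun _ => 0) 0 (fun f hf => hf P rfl)
      (fun f _ hf => by simpa using hf P rfl)
      (fun g hg => ⟨g, ?_, by simp⟩)).trans
    (relLength_le_finrank_adjoin hF hxt (fun f hf => ?_) hmul)))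
  · rintro R rfl
    exact hg
  · exact boundedSpace_mono (by simp) (hmul f hf)

theorem IsFunctionField.length_residueField (hF : IsFunctionField k F) (P : Place k F) :
    Module.length k P.ResidueField = P.degree := by
  have := hF.finite_residueField P
  exact Module.length_eq_finrank _ _

theorem IsFunctionField.degree_pos (hF : IsFunctionField k F) (P : Place k F) : 0 < P.degree := by
  have := hF.finite_residueField P
  exact Module.finrank_pos

/-- Lowering the bound by one at one place costs at most the degree of that place, since the leading
coefficient map detects the difference. -/
theorem IsFunctionField.relLength_boundedSpace_le (hF : IsFunctionField k F)
    (S : Set (Place k F)) (e : Place k F →₀ ℕ) (A : Place k F → ℤ) :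
    relLength (boundedSpace S fun P => A P - e P) (boundedSpace S A) ≤
      (e.sum fun P m => m * P.degree : ℕ) := by
  classical
  have hadd : ∀ e₁ e₂ : Place k F →₀ ℕ,
      (∀ A : Place k F → ℤ, relLength (boundedSpace S fun P => A P - e₁ P) (boundedSpace S A) ≤
        (e₁.sum fun P m => m * P.degree : ℕ)) →
      (∀ A : Place k F → ℤ, relLength (boundedSpace S fun P => A P - e₂ P) (boundedSpace S A) ≤
        (e₂.sum fun P m => m * P.degree : ℕ)) →
      ∀ A : Place k F → ℤ, relLength (boundedSpace S fun P => A P - (e₁ + e₂) P)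
        (boundedSpace S A) ≤ ((e₁ + e₂).sum fun P m => m * P.degree : ℕ) := by
    intro e₁ e₂ h₁ h₂ A
    rw [Finsupp.sum_add_index' (by simp) (by intros; ring), Nat.cast_add,
      relLength_add (B := boundedSpace S fun P => A P - e₂ P)
        (boundedSpace_mono fun P _ => by simp) (boundedSpace_mono fun P _ => by simp)]
    refine add_le_add ?_ (h₂ A)
    have : (fun P => A P - ((e₁ + e₂) P : ℕ)) = fun P => A P - e₂ P - e₁ P := by
      funext P
      rw [Finsupp.add_apply]
      push_cast
      ring
    rw [this]
    exact h₁ fun P => A P - e₂ P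
  induction e using Finsupp.induction_linear generalizing A with
  | zero => simp [relLength_self]
  | add e₁ e₂ h₁ h₂ => exact hadd e₁ e₂ h₁ h₂ A
  | single R n =>
    induction n generalizing A with
    | zero => simp [relLength_self]
    | succ n ih =>
      rw [Finsupp.single_add]
      refine hadd _ _ ih (fun A => ?_) A
      rw [Finsupp.sum_single_index (by simp), one_mul, ← hF.length_residueField]
      by_cases hR : R ∈ S
      · refine R.relLength_le_length_residueField (A R) (fun f hf => hf R hR) fun f hf hfR P hP => ?_
        rcases eq_or_ne P R with rfl | h
        · simpa using hfR
        · simpa [Finsupp.single_eq_of_ne h] using hf P hP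
      · have : (boundedSpace S fun P => A P - (Finsupp.single R 1 : Place k F →₀ ℕ) P) =
            boundedSpace S A :=
          le_antisymm (boundedSpace_mono fun P _ => by simp) (boundedSpace_mono fun P hP => by
            rw [Finsupp.single_eq_of_ne (by rintro rfl; exact hR hP)]
            simp)
        rw [this, relLength_self]
        exact zero_le

/-- Over a finite set of places, weak approximation makes each leading coefficient map surjective,
so every unit step costs the full degree. -/
theorem IsFunctionField.le_relLength_boundedSpace (hF : IsFunctionField k F)
    (S : Finset (Place k F)) (e : Place k F →₀ ℕ) (he : e.support ⊆ S) (A : Place k F → ℤ) :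
    (e.sum fun P m => m * P.degree : ℕ) ≤
      relLength (boundedSpace S fun P => A P - e P) (boundedSpace S A) := by
  classical
  have hadd : ∀ e₁ e₂ : Place k F →₀ ℕ,
      (∀ A : Place k F → ℤ, (e₁.sum fun P m => m * P.degree : ℕ) ≤
        relLength (boundedSpace S fun P => A P - e₁ P) (boundedSpace S A)) →
      (∀ A : Place k F → ℤ, (e₂.sum fun P m => m * P.degree : ℕ) ≤
        relLength (boundedSpace S fun P => A P - e₂ P) (boundedSpace S A)) →
      ∀ A : Place k F → ℤ, ((e₁ + e₂).sum fun P m => m * P.degree : ℕ) ≤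
        relLength (boundedSpace S fun P => A P - (e₁ + e₂) P) (boundedSpace S A) := by
    intro e₁ e₂ h₁ h₂ A
    rw [Finsupp.sum_add_index' (by simp) (by intros; ring), Nat.cast_add,
      relLength_add (B := boundedSpace S fun P => A P - e₂ P)
        (boundedSpace_mono fun P _ => by simp) (boundedSpace_mono fun P _ => by simp)]
    refine add_le_add ?_ (h₂ A)
    have : (fun P => A P - ((e₁ + e₂) P : ℕ)) = fun P => A P - e₂ P - e₁ P := by
      funext P
      rw [Finsupp.add_apply]
      push_cast
      ring
    rw [this]
    exact h₁ fun P => A P - e₂ P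
  induction e using Finsupp.induction_linear generalizing A with
  | zero => simp
  | add e₁ e₂ h₁ h₂ =>
    refine hadd e₁ e₂ (h₁ (subset_trans (fun P hP => ?_) he)) (h₂ (subset_trans (fun P hP => ?_) he)) A <;>
    · rw [Finsupp.mem_support_iff] at hP ⊢
      rw [Finsupp.add_apply]
      omega
  | single R n =>
    induction n generalizing A with
    | zero => simp
    | succ n ih =>
      have hR : R ∈ S := he (by simp)
      rw [Finsupp.single_add]
      refine hadd _ _ (ih (fun P hP => ?_)) (fun A => ?_) A
      · have := Finsupp.support_single_subset hP
        rw [Finset.mem_singleton] at this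
        rwa [this]
      rw [Finsupp.sum_single_index (by simp), one_mul, ← hF.length_residueField]
      refine R.length_residueField_le_relLength (A R) (fun f hf => hf R hR)
        (fun f _ hf => by simpa using hf R hR) fun g hg => ?_
      -- `f` has the leading coefficient of `g` at `R` and respects the bounds at the other places
      -- of `S`.
      obtain ⟨f, hf⟩ := Place.exists_forall_valuation_sub_le S (fun P => if P = R then g else 0)
        (fun P => if P = R then A R - 1 else A P)
      refine ⟨f, fun P hP => ?_, by simpa using hf R hR⟩
      rcases eq_or_ne P R with rfl | h
      · have h1 := hf P hP
        simp only [if_true] at h1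
        rw [← sub_add_cancel f g]
        exact (P.valuation.map_add _ _).trans
          (max_le (h1.trans (WithZero.exp_le_exp.2 (by omega))) hg)
      · simpa [h] using hf P hP

/-- The degree of (a part of) the zero divisor of `x` is at most `[F : k(x)]`. -/
theorem IsFunctionField.sum_zeros_le (hF : IsFunctionField k F) {x : F} (hx : Transcendental k x)
    (e : Place k F →₀ ℕ) (he : ∀ P ∈ e.support, P.valuation x ≤ WithZero.exp (-(e P : ℤ))) :
    (e.sum fun P m => m * P.degree) ≤ Module.finrank k⟮x⟯ F := by
  have hmul : ∀ f ∈ boundedSpace e.support (fun _ : Place k F => (0 : ℤ)),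
      x * f ∈ boundedSpace e.support (fun P : Place k F => (0 : ℤ) - e P) := by
    intro f hf P hP
    change _ ≤ WithZero.exp ((0 : ℤ) - e P)
    rw [map_mul, sub_eq_neg_add, WithZero.exp_add]
    exact mul_le_mul' (he P hP) (hf P hP)
  have h1 := (hF.le_relLength_boundedSpace e.support e subset_rfl (fun _ => 0)).trans
    (relLength_le_finrank_adjoin hF hx (fun f hf => boundedSpace_mono (by simp) (hmul f hf)) hmul)
  exact_mod_cast h1

/-- Each zero contributes at least `1` to a sum bounded by `[F : k(x)]`. -/
theorem IsFunctionField.finite_zeros (hF : IsFunctionField k F) {x : F}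
    (hx : Transcendental k x) : {P : Place k F | P.valuation x < 1}.Finite := by
  by_contra hinf
  obtain ⟨S, hS, hcard⟩ :=
    (Set.not_finite.1 hinf).exists_subset_card_eq (Module.finrank k⟮x⟯ F + 1)
  have h1 := hF.sum_zeros_le hx (Finsupp.indicator S fun _ _ => 1) (fun P hP => by
    have hPS : P ∈ S := Finsupp.support_indicator_subset _ _ hP
    rw [Finsupp.indicator_of_mem hPS]
    have : P.valuation x < WithZero.exp 0 := hS hPS
    rw [lt_exp_iff] at this
    simpa using this)
  have h2 : S.card ≤ (Finsupp.indicator S fun _ _ => 1).sum fun P m => m * P.degree := by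
    rw [Finsupp.sum_of_support_subset _ (Finsupp.support_indicator_subset _ _) _ (by simp),
      Finset.card_eq_sum_ones]
    refine Finset.sum_le_sum fun P hP => ?_
    rw [Finsupp.indicator_of_mem hP, one_mul]
    exact hF.degree_pos P
  omega

/-! ### Existence of zeros -/

open Polynomial in
open scoped IntermediateField.algebraAdjoinAdjoin in
/-- If `x` lies in the maximal ideal of a valuation ring `B` of the function field `F` containing
the constants, then every nonzero element of `B` divides a power of `x`. -/
theorem IsFunctionField.exists_pow_eq_mul (hF : IsFunctionField k F) {x : F}
    (hx : Transcendental k x) (B : ValuationSubring F) (hk : ∀ a : k, algebraMap k F a ∈ B)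
    (hxB : B.valuation x < 1) {y : F} (hy : y ∈ B) (hy0 : y ≠ 0) :
    ∃ n : ℕ, ∃ b ∈ B, x ^ n = y * b := by
  have hxmem : x ∈ B := (B.valuation_le_one_iff x).1 hxB.le
  have hpol : ∀ p : k[X], aeval x p ∈ B := by
    intro p
    rw [aeval_eq_sum_range]
    refine sum_mem fun i _ => ?_
    rw [Algebra.smul_def]
    exact mul_mem (hk _) (pow_mem hxmem i)
  have hA : ∀ c : Algebra.adjoin k {x}, ∃ p : k[X], aeval x p = (c : F) := fun c =>
    (Algebra.adjoin_singleton_eq_range_aeval k x).le c.2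
  have hunit : ∀ p : k[X], p.coeff 0 ≠ 0 → B.valuation (aeval x p) = 1 := by
    intro p hp
    conv_lhs => rw [← Polynomial.X_mul_divX_add p]
    rw [map_add, map_mul, aeval_X, aeval_C]
    have h1 : B.valuation (algebraMap k F (p.coeff 0)) = 1 := by
      refine le_antisymm ((B.valuation_le_one_iff _).2 (hk _)) ?_
      have h2 := (B.valuation_le_one_iff _).2 (hk (p.coeff 0)⁻¹)
      rw [map_inv₀, map_inv₀] at h2
      exact (inv_le_one₀ (zero_lt_iff.2 (by simpa using hp))).1 h2
    rw [Valuation.map_add_eq_of_lt_right, h1]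
    rw [h1, map_mul]
    exact (mul_le_of_le_one_right' ((B.valuation_le_one_iff _).2 (hpol _))).trans_lt hxB
  have halg : Algebra.IsAlgebraic (Algebra.adjoin k {x}) F := by
    have := hF.isAlgebraic_adjoin hx
    exact Algebra.IsAlgebraic.trans (Algebra.adjoin k {x}) k⟮x⟯ F
  obtain ⟨q, hq0, hq⟩ :=
    (halg.isAlgebraic y).exists_nonzero_coeff_and_aeval_eq_zero (mem_nonZeroDivisors_of_ne_zero hy0)
  obtain ⟨p, hp⟩ := hA (q.coeff 0)
  have hp0 : p ≠ 0 := by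
    rintro rfl
    rw [map_zero] at hp
    exact hq0 (Subtype.ext hp.symm)
  -- The constant coefficient of an equation of `y` over `k[x]` is a multiple of `y`. It is a power
  -- of `x` times a polynomial with nonzero constant term, and the latter is a unit of `B`.
  have hdvd : aeval x p = y * -aeval y q.divX := by
    rw [← Polynomial.X_mul_divX_add q, map_add, map_mul, aeval_X, aeval_C] at hq
    rw [hp, mul_neg]
    exact eq_neg_of_add_eq_zero_right hq
  have hdivX : aeval y q.divX ∈ B := by
    rw [aeval_eq_sum_range]
    refine sum_mem fun i _ => ?_
    rw [Algebra.smul_def]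
    obtain ⟨r, hr⟩ := hA (q.divX.coeff i)
    exact mul_mem (hr ▸ hpol r : ((q.divX.coeff i : Algebra.adjoin k {x}) : F) ∈ B) (pow_mem hy i)
  obtain ⟨m, r, hr0, hr⟩ : ∃ (m : ℕ) (r : k[X]), r.coeff 0 ≠ 0 ∧ p = X ^ m * r := by
    obtain ⟨r, hr⟩ := X_pow_dvd_iff.2 (fun d (hd : d < p.natTrailingDegree) =>
      coeff_eq_zero_of_lt_natTrailingDegree hd)
    have h1 : p.coeff p.natTrailingDegree ≠ 0 := by
      rwa [← trailingCoeff, trailingCoeff_nonzero_iff_nonzero]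
    generalize p.natTrailingDegree = m at hr h1
    refine ⟨m, r, ?_, hr⟩
    simpa [hr, coeff_X_pow_mul'] using h1
  have hru := hunit r hr0
  have hrne : aeval x r ≠ 0 := by
    intro h
    rw [h, map_zero] at hru
    exact zero_ne_one hru
  refine ⟨m, -aeval y q.divX * (aeval x r)⁻¹, mul_mem (neg_mem hdivX) ?_, ?_⟩
  · rw [← B.valuation_le_one_iff, map_inv₀, hru, inv_one]
  · rw [← mul_assoc, ← hdvd]
    conv_rhs => rw [hr]
    rw [map_mul, map_pow, aeval_X, mul_assoc, mul_inv_cancel₀ hrne, mul_one]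

/-- A valuation ring of a function field which contains the constants and has a transcendental
element in its maximal ideal is Noetherian. -/
theorem IsFunctionField.isNoetherianRing_valuationSubring (hF : IsFunctionField k F) {x : F}
    (hx : Transcendental k x) (B : ValuationSubring F) (hk : ∀ a : k, algebraMap k F a ∈ B)
    (hxB : B.valuation x < 1) : IsNoetherianRing B := by
  let _ : Algebra k B := RingHom.toAlgebra ((algebraMap k F).codRestrict B hk)
  have hxmem : x ∈ B := (B.valuation_le_one_iff x).1 hxB.le
  let V : Submodule k F :=
    { carrier := B
      zero_mem' := zero_mem B
      add_mem' := add_mem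
      smul_mem' := fun a f hf => by
        rw [Algebra.smul_def]
        exact mul_mem (hk a) hf }
  refine ⟨fun I => ?_⟩
  rcases eq_or_ne I ⊥ with rfl | hI
  · exact Submodule.fg_bot
  obtain ⟨y, hyI, hy0⟩ := Submodule.exists_mem_ne_zero_of_ne_bot hI
  obtain ⟨n, b, hb, hn⟩ := hF.exists_pow_eq_mul hx B hk hxB y.2 (by simpa using hy0)
  have hn' : (⟨x, hxmem⟩ : B) ^ (n + 1) ∈ I := by
    rw [pow_succ']
    have : (⟨x, hxmem⟩ : B) ^ n = y * ⟨b, hb⟩ := Subtype.ext hn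
    rw [this]
    exact Ideal.mul_mem_left I _ (Ideal.mul_mem_right _ I hyI)
  set J : Ideal B := Ideal.span {(⟨x, hxmem⟩ : B) ^ (n + 1)} with hJ
  have hxn : Transcendental k (x ^ (n + 1)) := hx.pow n.succ_pos
  let A : Submodule k F := V.map (LinearMap.mulLeft k (x ^ (n + 1)))
  let f : V →ₗ[k] (B ⧸ J) :=
    { toFun := fun v => Ideal.Quotient.mk J ⟨v, v.2⟩
      map_add' := fun v w => rfl
      map_smul' := fun a v => by
        rw [RingHom.id_apply, Algebra.smul_def, IsScalarTower.algebraMap_apply k B (B ⧸ J),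
          Ideal.Quotient.algebraMap_eq, ← map_mul]
        congr 1
        exact Subtype.ext (Algebra.smul_def a (v : F)) }
  have hmul : ∀ v ∈ V, x ^ (n + 1) * v ∈ A := fun v hv => ⟨v, hv, rfl⟩
  have hstab : ∀ v ∈ V, x ^ (n + 1) * v ∈ V := fun v (hv : v ∈ B) =>
    (mul_mem (pow_mem hxmem (n + 1)) hv : x ^ (n + 1) * v ∈ B)
  -- `J` is generated by a positive power of `x`, which is transcendental, so `dim (B / J) ≤ [F :
  -- k(x^{n+1})]`. As `J ≤ I`, the ideal `I` is then finitely generated.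
  have hfin : Module.Finite k (B ⧸ J) := by
    refine finite_of_length_ne_top (ne_top_of_le_ne_top (ENat.natCast_ne_top _)
      ((length_le_relLength_of_surjective (A := A) f ?_ ?_).trans
        (relLength_le_finrank_adjoin hF hxn hstab hmul)))
    · rintro ⟨_, hv⟩ ⟨v, hvV, rfl⟩
      rw [LinearMap.mem_ker]
      refine Ideal.Quotient.eq_zero_iff_mem.2 ?_
      rw [hJ, Ideal.mem_span_singleton]
      exact ⟨⟨v, hvV⟩, rfl⟩
    · intro c
      obtain ⟨c, rfl⟩ := Ideal.Quotient.mk_surjective c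
      exact ⟨⟨c, c.2⟩, rfl⟩
  have hnoeth : IsNoetherian B (B ⧸ J) := isNoetherian_of_tower k inferInstance
  refine Submodule.fg_of_fg_map_of_fg_inf_ker J.mkQ (IsNoetherian.noetherian _) ?_
  rw [Submodule.ker_mkQ, inf_eq_right.2 ((Ideal.span_singleton_le_iff_mem _).2 hn')]
  exact ⟨{(⟨x, hxmem⟩ : B) ^ (n + 1)}, by simp⟩

/-- Every transcendental element has a zero. -/
theorem IsFunctionField.exists_valuation_lt_one (hF : IsFunctionField k F) {x : F}
    (hx : Transcendental k x) : ∃ P : Place k F, P.valuation x < 1 := by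
  have hx0 : x ≠ 0 := by
    rintro rfl
    exact hx isAlgebraic_zero
  let A := (Algebra.adjoin k {x}).toSubring
  have hxA : x ∈ A := Algebra.self_mem_adjoin_singleton k x
  have hI : Ideal.span {(⟨x, hxA⟩ : A)} ≠ ⊤ := by
    rw [Ne, Ideal.span_singleton_eq_top, isUnit_iff_exists_inv]
    rintro ⟨⟨y, hy⟩, hxy⟩
    obtain ⟨p, rfl⟩ := (Algebra.adjoin_singleton_eq_range_aeval k x).le hy
    have h1 : x * Polynomial.aeval x p = 1 := congrArg Subtype.val hxy
    have h2 : Polynomial.X * p - 1 = 0 := by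
      refine (transcendental_iff.1 hx) _ ?_
      rw [map_sub, map_mul, Polynomial.aeval_X, h1, map_one, sub_self]
    have h3 := congrArg (Polynomial.coeff · 0) h2
    simp at h3
  -- Chevalley's extension theorem gives a valuation ring containing `k[x]` with `x` a nonunit.
  -- Being Noetherian it is principal, hence a discrete valuation ring, whose valuation is the
  -- desired place.
  obtain ⟨B, hAB, hIB⟩ := Ideal.image_subset_nonunits_valuationSubring _ hI
  have hk : ∀ a : k, algebraMap k F a ∈ B := fun a => hAB ((Algebra.adjoin k {x}).algebraMap_mem a)
  have hxB : B.valuation x < 1 :=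
    B.mem_nonunits_iff.1 (hIB ⟨⟨x, hxA⟩, Ideal.mem_span_singleton_self _, rfl⟩)
  have hxmem : x ∈ B := hAB hxA
  have hxm : (⟨x, hxmem⟩ : B) ∈ IsLocalRing.maximalIdeal B :=
    (B.valuation_lt_one_iff _).2 hxB
  have hN : IsNoetherianRing B := hF.isNoetherianRing_valuationSubring hx B hk hxB
  have hP : IsPrincipalIdealRing B := (IsBezout.TFAE.out 0 1).1 hN
  have hD : IsDiscreteValuationRing B :=
    { not_a_field' := fun h => hx0 (by
        rw [h, Ideal.mem_bot] at hxm
        exact congrArg Subtype.val hxm) }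
  refine ⟨⟨(IsDiscreteValuationRing.maximalIdeal B).valuation F,
    IsDedekindDomain.HeightOneSpectrum.valuation_surjective F _, fun a =>
    IsDedekindDomain.HeightOneSpectrum.valuation_le_one _ (⟨_, hk a⟩ : B)⟩, ?_⟩
  exact (IsDedekindDomain.HeightOneSpectrum.valuation_lt_one_iff_mem _ (⟨x, hxmem⟩ : B)).2 hxm

/-! ### Dimension of Riemann-Roch spaces and the degree of the poles -/

theorem IsFunctionField.isAlgebraic_of_mem_boundedSpace_zero (hF : IsFunctionField k F) {f : F}
    (hf : f ∈ boundedSpace (Set.univ : Set (Place k F)) 0) : IsAlgebraic k f := by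
  by_contra h
  have h1 : Transcendental k f⁻¹ := fun h' => h (by simpa using h'.inv)
  obtain ⟨P, hP⟩ := hF.exists_valuation_lt_one h1
  have hf0 : f ≠ 0 := by
    rintro rfl
    exact h isAlgebraic_zero
  have h2 : P.valuation f ≤ 1 := hf P trivial
  rw [map_inv₀, inv_lt_one₀ (zero_lt_iff.2 (by simpa using hf0))] at hP
  exact absurd h2 (not_le.2 hP)

/-- Functions without poles are constants, by fullness of the constant field; allowing the poles of
`e` adds at most `deg e` dimensions. -/
theorem IsFunctionField.length_boundedSpace_le (hF : IsFunctionField k F)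
    (hk : IsFullConstantField k F) (e : Place k F →₀ ℕ) :
    Module.length k (boundedSpace (Set.univ : Set (Place k F)) fun P => (e P : ℤ)) ≤
      ((e.sum fun P m => m * P.degree) + 1 : ℕ) := by
  have h0 : boundedSpace (Set.univ : Set (Place k F)) 0 ≤ Submodule.span k {(1 : F)} := by
    intro f hf
    have h1 : f ∈ algebraicClosure k F := by
      rw [mem_algebraicClosure_iff]
      exact hF.isAlgebraic_of_mem_boundedSpace_zero hf
    rw [hk, IntermediateField.mem_bot] at h1
    obtain ⟨a, rfl⟩ := h1
    rw [Algebra.algebraMap_eq_smul_one]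
    exact Submodule.smul_mem _ _ (Submodule.mem_span_singleton_self _)
  have h1 : Module.length k (boundedSpace (Set.univ : Set (Place k F)) 0) ≤ 1 := by
    refine (Module.length_le_of_injective (Submodule.inclusion h0)
      (Submodule.inclusion_injective h0)).trans ?_
    rw [Module.length_eq_finrank, finrank_span_singleton one_ne_zero, Nat.cast_one]
  have h2 := hF.relLength_boundedSpace_le Set.univ e fun P => e P
  simp only [sub_self] at h2
  rw [← relLength_bot, relLength_add (B := boundedSpace Set.univ 0) bot_le
    (boundedSpace_mono fun P _ => by simp), relLength_bot, add_comm, Nat.cast_add]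
  exact add_le_add h2 (by simpa using h1)

theorem IsFunctionField.exists_mem_boundedSpace (hF : IsFunctionField k F) (f : F) :
    ∃ e : Place k F →₀ ℕ, f ∈ boundedSpace (Set.univ : Set (Place k F)) fun P => (e P : ℤ) := by
  by_cases hf : IsAlgebraic k f
  · exact ⟨0, fun P _ => by simpa using P.valuation_le_one_of_isAlgebraic hf⟩
  have h1 : Transcendental k f⁻¹ := fun h' => hf (by simpa using h'.inv)
  have hf0 : f ≠ 0 := by
    rintro rfl
    exact hf isAlgebraic_zero
  refine ⟨Finsupp.onFinset (hF.finite_zeros h1).toFinset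
    (fun P => (WithZero.log (P.valuation f)).toNat) fun P hP => ?_, fun P _ => ?_⟩
  · rw [Set.Finite.mem_toFinset, Set.mem_ofPred_eq, map_inv₀,
      inv_lt_one₀ (zero_lt_iff.2 (by simpa using hf0)), ← WithZero.exp_zero,
      ← WithZero.lt_log_iff_exp_lt (by simpa using hf0)]
    omega
  · refine WithZero.le_exp_of_log_le ?_
    exact Int.self_le_toNat _

theorem linearIndependent_gen_pow {g : F} (hg : Transcendental k g) :
    LinearIndependent k fun n : ℕ => (IntermediateField.AdjoinSimple.gen k g) ^ n := by
  have hg' : Transcendental k (IntermediateField.AdjoinSimple.gen k g) := fun h =>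
    hg (h.algebraMap (A := F))
  have h := (Polynomial.basisMonomials k).linearIndependent.map'
    (Polynomial.aeval (IntermediateField.AdjoinSimple.gen k g)).toLinearMap
    (LinearMap.ker_eq_bot.2 (transcendental_iff_injective.1 hg'))
  have he : (Polynomial.aeval (IntermediateField.AdjoinSimple.gen k g)).toLinearMap ∘
      Polynomial.basisMonomials k = fun n : ℕ => (IntermediateField.AdjoinSimple.gen k g) ^ n := by
    funext n
    simp
  rw [he] at h
  exact h

theorem linearIndependent_pow_mul {g : F} (hg : Transcendental k g) {ι : Type*} {u : ι → F}
    (hu : LinearIndependent k⟮g⟯ u) :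
    LinearIndependent k fun p : ℕ × ι => g ^ p.1 * u p.2 :=
  linearIndependent_smul (linearIndependent_gen_pow hg) hu

/-- If the pole divisor of a transcendental element `g` is at most `e`, then
`[F : k(g)] ≤ deg e`. -/
theorem IsFunctionField.finrank_adjoin_le (hF : IsFunctionField k F)
    (hk : IsFullConstantField k F) {g : F} (hg : Transcendental k g) (e : Place k F →₀ ℕ)
    (hge : g ∈ boundedSpace (Set.univ : Set (Place k F)) fun P => (e P : ℤ)) :
    Module.finrank k⟮g⟯ F ≤ e.sum fun P m => m * P.degree := by
  have := hF.finiteDimensional_adjoin hg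
  let u := Module.finBasis k⟮g⟯ F
  choose C hC using fun i => hF.exists_mem_boundedSpace (u i)
  set d := e.sum fun P m => m * P.degree with hd
  set c := (∑ i, C i).sum fun P m => m * P.degree with hc
  have hmem : ∀ (l : ℕ) (p : Fin (l + 1) × Fin (Module.finrank k⟮g⟯ F)),
      g ^ (p.1 : ℕ) * u p.2 ∈ boundedSpace (Set.univ : Set (Place k F))
        fun P => (((l • e + ∑ i, C i : Place k F →₀ ℕ) P : ℕ) : ℤ) := by
    intro l p P _
    rw [map_mul, map_pow]
    have h1 : P.valuation g ^ (p.1 : ℕ) ≤ WithZero.exp ((l * e P : ℕ) : ℤ) := by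
      refine (pow_le_pow_left' (hge P trivial) _).trans ?_
      rw [← WithZero.exp_nsmul, WithZero.exp_le_exp, nsmul_eq_mul]
      beta_reduce
      exact_mod_cast Nat.mul_le_mul_right _ (Nat.lt_succ_iff.1 p.1.2)
    have h2 : P.valuation (u p.2) ≤ WithZero.exp (((∑ i, C i) P : ℕ) : ℤ) := by
      refine (hC p.2 P trivial).trans ?_
      rw [WithZero.exp_le_exp, Finsupp.finsetSum_apply]
      beta_reduce
      exact_mod_cast Finset.single_le_sum (f := fun i => C i P) (fun _ _ => Nat.zero_le _)
        (Finset.mem_univ p.2)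
    refine (mul_le_mul' h1 h2).trans ?_
    rw [← WithZero.exp_add, WithZero.exp_le_exp]
    beta_reduce
    rw [Finsupp.add_apply, Finsupp.smul_apply, smul_eq_mul, Nat.cast_add]
  -- The products `g^i u_j` with `i ≤ l` are independent over `k`, and their poles are bounded by `l
  -- e + ∑ C i`. Letting `l` grow compares `[F : k(g)]` with `d`.
  have key : ∀ l : ℕ, (l + 1) * Module.finrank k⟮g⟯ F ≤ l * d + c + 1 := by
    intro l
    have hlin : LinearIndependent k fun p : Fin (l + 1) × Fin (Module.finrank k⟮g⟯ F) =>
        (⟨g ^ (p.1 : ℕ) * u p.2, hmem l p⟩ : boundedSpace (Set.univ : Set (Place k F))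
          fun P => (((l • e + ∑ i, C i : Place k F →₀ ℕ) P : ℕ) : ℤ)) := by
      refine LinearIndependent.of_comp (Submodule.subtype _) ?_
      exact (linearIndependent_pow_mul hg u.linearIndependent).comp
        (Prod.map (fun i : Fin (l + 1) => (i : ℕ)) id)
        (Fin.val_injective.prodMap Function.injective_id)
    have hlen := hF.length_boundedSpace_le hk (l • e + ∑ i, C i)
    have hfin := finite_of_length_ne_top (ne_top_of_le_ne_top (ENat.natCast_ne_top _) hlen)
    rw [Module.length_eq_finrank, Finsupp.sum_add_index' (by simp) (by intros; ring),
      Finsupp.sum_smul_index (by simp)] at hlen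
    have h1 := hlin.fintype_card_le_finrank
    rw [Fintype.card_prod, Fintype.card_fin, Fintype.card_fin] at h1
    simp_rw [mul_assoc, ← Finsupp.mul_sum] at hlen
    exact h1.trans (by exact_mod_cast hlen)
  by_contra hlt
  -- If `[F : k(g)] ≥ d + 1`, then `key` forces `d + l ≤ c`, which fails for `l = c + 1`.
  have h1 := key (c + 1)
  have h2 : (c + 1 + 1) * (d + 1) ≤ (c + 1 + 1) * Module.finrank k⟮g⟯ F :=
    Nat.mul_le_mul_left _ (by omega)
  nlinarith

/-- A nonzero function in the Riemann-Roch space of an effective divisor `e` has at most `deg e`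
zeros, counted with multiplicity and degree. -/
theorem IsFunctionField.sum_zeros_le_degree (hF : IsFunctionField k F)
    (hk : IsFullConstantField k F) {g : F} (hg0 : g ≠ 0) (e : Place k F →₀ ℕ)
    (hge : g ∈ boundedSpace (Set.univ : Set (Place k F)) fun P => (e P : ℤ))
    (z : Place k F →₀ ℕ) (hz : ∀ P ∈ z.support, P.valuation g ≤ WithZero.exp (-(z P : ℤ))) :
    (z.sum fun P m => m * P.degree) ≤ e.sum fun P m => m * P.degree := by
  by_cases hg : IsAlgebraic k g
  · have : z = 0 := by
      rw [← Finsupp.support_eq_empty, Finset.eq_empty_iff_forall_notMem]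
      intro P hP
      have h := hz P hP
      rw [P.valuation_eq_one_of_isAlgebraic hg hg0, ← WithZero.exp_zero,
        WithZero.exp_le_exp] at h
      rw [Finsupp.mem_support_iff] at hP
      omega
    simp [this]
  · exact (hF.sum_zeros_le hg z hz).trans (hF.finrank_adjoin_le hk hg e hge)

/-! ### Finiteness of the set of places of given degree -/

/-- The residue field of such a place has `q = |k|^r` elements, so the place is a pole of `z` or a
zero of `z^q - z`; both functions have finitely many of these. -/
theorem IsFunctionField.finite_setOf_degree_eq [Finite k] (hF : IsFunctionField k F) (r : ℕ) :
    {P : Place k F | P.degree = r}.Finite := by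
  have hF' := hF
  obtain ⟨z, hz, -⟩ := hF'
  rcases Nat.eq_zero_or_pos r with rfl | hr
  · convert Set.finite_empty
    ext P
    simpa using (hF.degree_pos P).ne'
  set q := Nat.card k ^ r with hq
  have hq1 : 1 < q := Nat.one_lt_pow hr.ne' Finite.one_lt_card
  have hz0 : z ≠ 0 := by
    rintro rfl
    exact hz isAlgebraic_zero
  have hzi : Transcendental k z⁻¹ := fun h => hz (by simpa using h.inv)
  have hh : Transcendental k (z ^ q - z) := by
    have h1 : z ^ q - z = Polynomial.aeval z (Polynomial.X ^ q - Polynomial.X : Polynomial k) := by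
      simp
    rw [h1]
    have h2 : (Polynomial.X ^ q - Polynomial.X : Polynomial k).natDegree = q :=
      FiniteField.X_pow_card_sub_X_natDegree_eq k hq1
    exact hz.aeval _ (by omega) (mem_nonZeroDivisors_of_ne_zero
      (Polynomial.leadingCoeff_ne_zero.2 (FiniteField.X_pow_card_sub_X_ne_zero k hq1)))
  refine ((hF.finite_zeros hzi).union (hF.finite_zeros hh)).subset fun P hP => ?_
  by_cases hzP : P.valuation z ≤ 1
  · right
    have := hF.finite_residueField P
    have hfin : Finite P.ResidueField := Module.finite_of_finite k
    have hcard : Nat.card P.ResidueField = q := by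
      rw [Module.natCard_eq_pow_finrank (K := k)]
      exact congrArg _ hP
    have := Fintype.ofFinite P.ResidueField
    have h1 := FiniteField.pow_card
      (IsLocalRing.residue P.ring ⟨z, (P.mem_ring_iff _).2 hzP⟩)
    rw [← Nat.card_eq_fintype_card, hcard, ← sub_eq_zero, ← map_pow, ← map_sub,
      IsLocalRing.residue_eq_zero_iff, ValuationSubring.valuation_lt_one_iff] at h1
    exact (Valuation.isEquiv_valuation_valuationSubring P.valuation).lt_one_iff_lt_one.2 h1
  · left
    rw [Set.mem_ofPred_eq, map_inv₀]
    exact inv_lt_one_of_one_lt₀ (not_le.1 hzP)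

/-! ### A unique place above a rational place, and independence over `K` -/

namespace Place

variable {K : IntermediateField k F} {Q : Place k K} {R : Place k F}

theorem LiesAbove.valuation_le_one_iff (h : R.LiesAbove Q) (x : K) :
    R.valuation x ≤ 1 ↔ Q.valuation x ≤ 1 := by
  rw [← mem_ring_iff, ← mem_ring_iff]
  exact h x

theorem LiesAbove.valuation_lt_one_iff (h : R.LiesAbove Q) (x : K) :
    R.valuation x < 1 ↔ Q.valuation x < 1 := by
  rcases eq_or_ne x 0 with rfl | hx
  · simp
  have h1 := h.valuation_le_one_iff x⁻¹
  have hx1 : 0 < R.valuation (x : F) := zero_lt_iff.2 (by simpa using hx)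
  have hx2 : 0 < Q.valuation x := zero_lt_iff.2 (by simpa using hx)
  have hi : ((x⁻¹ : K) : F) = (x : F)⁻¹ := rfl
  rw [hi, map_inv₀, map_inv₀, inv_le_one₀ hx1, inv_le_one₀ hx2] at h1
  rw [← not_le, h1, not_le]

theorem LiesAbove.conj (h : R.LiesAbove Q) (τ : F ≃ₐ[K] F) :
    (R.conj (τ.restrictScalars k)).LiesAbove Q := by
  intro x
  rw [← h x, mem_ring_iff, mem_ring_iff]
  change R.valuation (τ.symm (algebraMap K F x)) ≤ 1 ↔ R.valuation (algebraMap K F x) ≤ 1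
  rw [AlgEquiv.commutes]

theorem LiesAbove.valuation_algEquiv (h : R.LiesAbove Q)
    (huniq : ∀ P : Place k F, P.LiesAbove Q → P = R) (τ : F ≃ₐ[K] F) (f : F) :
    R.valuation (τ f) = R.valuation f := by
  conv_rhs => rw [← huniq _ (h.conj τ.symm)]
  rfl

/-- The trace is the sum of the Galois conjugates, which all have the same valuation at the unique
place `R`. -/
theorem LiesAbove.valuation_trace_le_one [FiniteDimensional K F] [IsGalois K F]
    (h : R.LiesAbove Q) (huniq : ∀ P : Place k F, P.LiesAbove Q → P = R) {y : F}
    (hy : R.valuation y ≤ 1) : Q.valuation (Algebra.trace K F y) ≤ 1 := by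
  rw [← h.valuation_le_one_iff]
  have h1 := trace_eq_sum_automorphisms (K := K) (L := F) y
  change R.valuation (algebraMap K F (Algebra.trace K F y)) ≤ 1
  rw [h1]
  refine R.valuation.map_sum_le fun τ _ => ?_
  rwa [h.valuation_algEquiv huniq]

theorem exists_pow_mul_valuation_le_one {t : F} (ht : R.valuation t < 1) (f : F) :
    ∃ n : ℕ, R.valuation (t ^ n * f) ≤ 1 := by
  rcases eq_or_ne t 0 with rfl | ht0
  · exact ⟨1, by simp⟩
  rcases eq_or_ne f 0 with rfl | hf0
  · exact ⟨0, by simp⟩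
  have h1 : R.valuation t ≠ 0 := by simpa using ht0
  have h2 : R.valuation f ≠ 0 := by simpa using hf0
  have h3 : WithZero.log (R.valuation t) < 0 := by
    rwa [WithZero.log_lt_iff_lt_exp h1, WithZero.exp_zero]
  refine ⟨(WithZero.log (R.valuation f)).toNat, ?_⟩
  rw [map_mul, map_pow, ← WithZero.exp_zero, ← WithZero.log_le_iff_le_exp
    (mul_ne_zero (pow_ne_zero _ h1) h2), WithZero.log_mul (pow_ne_zero _ h1) h2,
    WithZero.log_pow, nsmul_eq_mul]
  have h4 := Int.self_le_toNat (WithZero.log (R.valuation f))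
  nlinarith [Int.natCast_nonneg (WithZero.log (R.valuation f)).toNat]

/-- If `R` is the only place above `Q` in the Galois extension `F / K` and a family spans the
valuation ring of `R` over `k` modulo a uniformizer of `Q`, then it spans `F` over `K`. -/
theorem LiesAbove.span_eq_top [FiniteDimensional K F] [IsGalois K F]
    (h : R.LiesAbove Q) (huniq : ∀ P : Place k F, P.LiesAbove Q → P = R)
    {t : K} (ht : Q.valuation t = WithZero.exp (-1)) {s : Set F}
    (hs : ∀ f, R.valuation f ≤ 1 → ∃ g ∈ Submodule.span k s,
      R.valuation (f - g) ≤ R.valuation (t : F)) :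
    Submodule.span K s = ⊤ := by
  by_contra hne
  -- If the span is proper, a nonzero functional `φ` kills it, and `φ` is `y ↦ Tr (c y)` by
  -- nondegeneracy of the trace form.
  obtain ⟨φ, hφ0, hφ⟩ := (Submodule.span K s).exists_le_ker_of_lt_top (lt_top_iff_ne_top.2 hne)
  set c := ((Algebra.traceForm K F).toDual (traceForm_nondegenerate K F)).symm φ with hc
  have hφc : ∀ y, Algebra.trace K F (c * y) = φ y := fun y =>
    LinearMap.BilinForm.apply_toDual_symm_apply (hB := traceForm_nondegenerate K F) φ y
  have ht0 : t ≠ 0 := ne_zero_of_valuation_eq_exp ht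
  have ht0' : (t : F) ≠ 0 := by simpa using ht0
  have ht1 : R.valuation (t : F) < 1 := by
    rw [h.valuation_lt_one_iff, ht, ← WithZero.exp_zero, WithZero.exp_lt_exp]
    simp
  obtain ⟨a, ha⟩ := exists_pow_mul_valuation_le_one ht1 c
  -- Integrality of the trace gives a uniform pole bound on `O_R`. Since `φ y = t φ ((y - g) / t)`
  -- with `g` in the span, the bound improves by one each time, so `φ` vanishes on `O_R` and, after
  -- clearing poles by powers of `t`, on `F`.
  have hbound : ∀ m : ℕ, ∀ y, R.valuation y ≤ 1 → Q.valuation (φ y) ≤ WithZero.exp ((a : ℤ) - m) := by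
    intro m
    induction m with
    | zero =>
      intro y hy
      have h1 : R.valuation (t ^ a * c * y) ≤ 1 := by
        rw [map_mul]
        exact mul_le_one' ha hy
      have h2 := h.valuation_trace_le_one huniq h1
      have h3 : Algebra.trace K F (t ^ a * c * y) = t ^ a * φ y := by
        rw [← hφc, mul_assoc, ← smul_eq_mul (t ^ a), ← map_smul, Algebra.smul_def, map_pow]
        rfl
      rw [h3, map_mul, map_pow, ht, ← WithZero.exp_nsmul] at h2
      have h4 : Q.valuation (φ y) = WithZero.exp (a : ℤ) *
          (WithZero.exp (a • (-1 : ℤ)) * Q.valuation (φ y)) := by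
        rw [← mul_assoc, ← WithZero.exp_add]
        simp
      rw [h4]
      simpa using mul_le_mul_right h2 (WithZero.exp (a : ℤ))
    | succ m ih =>
      intro y hy
      obtain ⟨g, hg, hyg⟩ := hs y hy
      have hg0 : φ g = 0 := hφ (Submodule.span_le_restrictScalars k K s hg)
      have h1 : φ y = t * φ ((y - g) / t) := by
        rw [← smul_eq_mul t, ← map_smul, Algebra.smul_def]
        change φ y = φ ((t : F) * ((y - g) / t))
        rw [mul_div_cancel₀ _ ht0', map_sub, hg0, sub_zero]
      rw [h1, map_mul, ht]
      have h2 := ih ((y - g) / t) (by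
        rw [map_div₀]
        exact div_le_one_of_le₀ hyg zero_le)
      refine (mul_le_mul_right h2 _).trans ?_
      rw [← WithZero.exp_add, WithZero.exp_le_exp]
      push_cast
      omega
  have hzero : ∀ y, R.valuation y ≤ 1 → φ y = 0 := by
    intro y hy
    by_contra hy0
    have hv : Q.valuation (φ y) ≠ 0 := by simpa using hy0
    have h1 := hbound (a - WithZero.log (Q.valuation (φ y)) + 1).toNat y hy
    rw [← WithZero.log_le_iff_le_exp hv] at h1
    have := Int.self_le_toNat (a - WithZero.log (Q.valuation (φ y)) + 1)
    omega
  refine hφ0 (LinearMap.ext fun y => ?_)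
  obtain ⟨n, hn⟩ := exists_pow_mul_valuation_le_one ht1 y
  have h1 := hzero _ hn
  have h2 : φ ((t : F) ^ n * y) = t ^ n * φ y := by
    rw [← smul_eq_mul (t ^ n), ← map_smul, Algebra.smul_def, map_pow]
    rfl
  rw [h2] at h1
  simpa [ht0] using h1

/-- Modulo `t`, the ring `O_R` has dimension at most `e deg R` over `k`, and lifts of a basis of the
quotient span `F` over `K`. -/
theorem LiesAbove.finrank_le [FiniteDimensional K F] [IsGalois K F] (hF : IsFunctionField k F)
    (h : R.LiesAbove Q) (huniq : ∀ P : Place k F, P.LiesAbove Q → P = R)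
    {t : K} (ht : Q.valuation t = WithZero.exp (-1)) {e : ℕ}
    (hte : R.valuation (t : F) = WithZero.exp (-(e : ℤ))) :
    Module.finrank K F ≤ e * R.degree := by
  classical
  have h1 := hF.relLength_boundedSpace_le {R} (Finsupp.single R e) 0
  rw [Finsupp.sum_single_index (by simp)] at h1
  set A := boundedSpace {R} fun P => (0 : Place k F → ℤ) P - (Finsupp.single R e : Place k F →₀ ℕ) P
    with hA
  set B := boundedSpace {R} (0 : Place k F → ℤ) with hB
  have hfin : Module.Finite k (B ⧸ A.submoduleOf B) :=
    finite_of_length_ne_top (ne_top_of_le_ne_top (ENat.natCast_ne_top _) h1)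
  rw [relLength, Module.length_eq_finrank, Nat.cast_le] at h1
  refine le_trans ?_ h1
  let b := Module.finBasis k (B ⧸ A.submoduleOf B)
  choose w hw using fun i => Submodule.Quotient.mk_surjective _ (b i)
  rw [← Fintype.card_fin (Module.finrank k (B ⧸ A.submoduleOf B))]
  refine finrank_le_of_span_eq_top (v := fun i => (w i : F))
    (h.span_eq_top huniq ht fun f hf => ?_)
  have hfB : f ∈ B := by
    rintro P rfl
    simpa using hf
  refine ⟨∑ i, b.repr (Submodule.Quotient.mk ⟨f, hfB⟩) i • (w i : F),
    sum_mem fun i _ => Submodule.smul_mem _ _ (Submodule.subset_span ⟨i, rfl⟩), ?_⟩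
  have h2 : (⟨f, hfB⟩ - ∑ i, b.repr (Submodule.Quotient.mk ⟨f, hfB⟩) i • w i : B) ∈
      A.submoduleOf B := by
    rw [← Submodule.Quotient.mk_eq_zero, ← Submodule.mkQ_apply, map_sub, map_sum, sub_eq_zero]
    simp only [map_smul, Submodule.mkQ_apply, hw]
    exact (b.sum_repr _).symm
  have h3 := h2 R rfl
  rw [hte]
  simpa using h3

theorem exists_valuation_sub_algebraMap_lt_one {L : Type*} [Field L] [Algebra k L] {Q : Place k L}
    (hQ : Q.degree = 1) {x : L} (hx : Q.valuation x ≤ 1) :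
    ∃ c : k, Q.valuation (x - algebraMap k L c) < 1 := by
  obtain ⟨c, hc⟩ := (finrank_eq_one_iff_of_nonzero' (1 : Q.ResidueField) one_ne_zero).1 hQ
    (IsLocalRing.residue Q.ring ⟨x, (Q.mem_ring_iff _).2 hx⟩)
  refine ⟨c, ?_⟩
  rw [← Algebra.algebraMap_eq_smul_one, IsScalarTower.algebraMap_apply k Q.ring Q.ResidueField,
    IsLocalRing.ResidueField.algebraMap_eq, eq_comm, ← sub_eq_zero, ← map_sub,
    IsLocalRing.residue_eq_zero_iff, ValuationSubring.valuation_lt_one_iff] at hc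
  exact (Valuation.isEquiv_valuation_valuationSubring Q.valuation).lt_one_iff_lt_one.2 hc

/-- Functions regular at a place `R` above the rational place `Q` of `K` are linearly independent
over `K` if they are linearly independent over `k` modulo a uniformizer of `Q`. -/
theorem LiesAbove.linearIndependent (h : R.LiesAbove Q) (hQ : Q.degree = 1)
    {t : K} (ht : Q.valuation t = WithZero.exp (-1)) {ι : Type*} [Fintype ι] {w : ι → F}
    (hw : ∀ i, R.valuation (w i) ≤ 1)
    (hind : ∀ c : ι → k, R.valuation (∑ i, c i • w i) ≤ R.valuation (t : F) → c = 0) :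
    LinearIndependent K w := by
  rw [Fintype.linearIndependent_iff]
  intro a hsum
  by_contra! hne
  obtain ⟨i₀, hi₀⟩ := hne
  -- Dividing by a coefficient of largest valuation makes all coefficients integral at `Q` and one
  -- of them `1`, so the residues `c` cannot all vanish.
  obtain ⟨j, -, hj⟩ := Finset.exists_max_image Finset.univ (fun i => Q.valuation (a i))
    ⟨i₀, Finset.mem_univ _⟩
  have hj0 : a j ≠ 0 := by
    intro h0
    have := hj i₀ (Finset.mem_univ _)
    rw [h0, map_zero, le_zero_iff, map_eq_zero] at this
    exact hi₀ this
  have ht0 : t ≠ 0 := ne_zero_of_valuation_eq_exp ht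
  have ht0' : (t : F) ≠ 0 := by simpa using ht0
  have hle : ∀ i, Q.valuation (a i / a j) ≤ 1 := fun i => by
    rw [map_div₀]
    exact div_le_one_of_le₀ (hj i (Finset.mem_univ _)) zero_le
  choose c hc using fun i => exists_valuation_sub_algebraMap_lt_one hQ (hle i)
  have hc0 : c = 0 := by
    apply hind
    have h1 : ∑ i, c i • w i = -∑ i, ((a i / a j - algebraMap k K (c i) : K) : F) * w i := by
      rw [eq_neg_iff_add_eq_zero, ← Finset.sum_add_distrib]
      have h2 : ∀ i, c i • w i + ((a i / a j - algebraMap k K (c i) : K) : F) * w i =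
          (a j : F)⁻¹ * (a i • w i) := by
        intro i
        rw [Algebra.smul_def, Algebra.smul_def]
        change algebraMap k F (c i) * w i + ((a i : F) / a j - algebraMap k F (c i)) * w i =
          (a j : F)⁻¹ * ((a i : F) * w i)
        ring
      simp_rw [h2]
      rw [← Finset.mul_sum, hsum, mul_zero]
    rw [h1, Valuation.map_neg]
    refine R.valuation.map_sum_le fun i _ => ?_
    rw [map_mul]
    refine (mul_le_of_le_one_right' (hw i)).trans ?_
    have h3 : R.valuation (((a i / a j - algebraMap k K (c i)) / t : K) : F) ≤ 1 := by
      rw [h.valuation_le_one_iff, map_div₀, ht, div_le_one₀ WithZero.exp_pos]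
      have h4 := hc i
      rw [← WithZero.exp_zero, lt_exp_iff] at h4
      simpa using h4
    have h5 : (((a i / a j - algebraMap k K (c i)) / t : K) : F) =
      ((a i / a j - algebraMap k K (c i) : K) : F) / (t : F) := rfl
    rw [h5, map_div₀] at h3
    exact (div_le_one₀ (zero_lt_iff.2 (by simpa using ht0))).1 h3
  have h6 := hc j
  rw [hc0, div_self hj0] at h6
  simp at h6

/-- Functions in the Riemann-Roch space of an effective divisor `e` of degree less than `[F : K]`
that are linearly independent over `k` remain so over `K`, provided that `K` has a rational place
with a unique place of `F` above it, outside the support of `e`. -/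
theorem LiesAbove.linearIndependent_of_boundedSpace [FiniteDimensional K F] [IsGalois K F]
    (hF : IsFunctionField k F) (hk : IsFullConstantField k F)
    (h : R.LiesAbove Q) (huniq : ∀ P : Place k F, P.LiesAbove Q → P = R) (hQ : Q.degree = 1)
    {e : Place k F →₀ ℕ} (heR : e R = 0)
    (hdeg : (e.sum fun P m => m * P.degree) < Module.finrank K F)
    {ι : Type*} [Fintype ι] {w : ι → F}
    (hw : ∀ i, w i ∈ boundedSpace (Set.univ : Set (Place k F)) fun P => (e P : ℤ))
    (hlin : LinearIndependent k w) : LinearIndependent K w := by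
  obtain ⟨t, ht⟩ := Q.exists_valuation_eq_exp (-1)
  have ht0 : t ≠ 0 := ne_zero_of_valuation_eq_exp ht
  have htR : R.valuation (t : F) ≠ 0 := by simpa using ht0
  have ht1 : R.valuation (t : F) < 1 := by
    rw [h.valuation_lt_one_iff, ht, ← WithZero.exp_zero, WithZero.exp_lt_exp]
    simp
  obtain ⟨n, hn⟩ : ∃ n : ℕ, R.valuation (t : F) = WithZero.exp (-(n : ℤ)) := by
    rw [← WithZero.exp_zero, ← WithZero.log_lt_iff_lt_exp htR] at ht1
    refine ⟨(-WithZero.log (R.valuation (t : F))).toNat, ?_⟩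
    rw [Int.toNat_of_nonneg (by omega), neg_neg, WithZero.exp_log htR]
  have hN := h.finrank_le hF huniq ht hn
  refine h.linearIndependent hQ ht (fun i => by simpa [heR] using hw i R trivial) fun c hc => ?_
  have hzero : ∑ i, c i • w i = 0 := by
    by_contra hne
    have h1 := hF.sum_zeros_le_degree hk hne e
      (sum_mem fun i _ => Submodule.smul_mem _ _ (hw i)) (Finsupp.single R n) (fun P hP => by
        have hPR : P = R := by simpa using Finsupp.support_single_subset hP
        subst hPR
        rw [Finsupp.single_eq_same, ← hn]
        exact hc)
    rw [Finsupp.sum_single_index (by simp)] at h1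
    omega
  exact funext (Fintype.linearIndependent_iff.1 hlin c hzero)

end Place

/-! ### Casorati determinants -/

theorem isGalois_fixedField_zpowers {σ : F ≃ₐ[k] F} (hσ : IsOfFinOrder σ) :
    IsGalois (IntermediateField.fixedField (Subgroup.zpowers σ)) F := by
  have : Finite (Subgroup.zpowers σ) := hσ.finite_zpowers
  exact IsGalois.of_fixed_field F (Subgroup.zpowers σ)

theorem mem_fixedField_zpowers {σ : F ≃ₐ[k] F} {a : F} (ha : σ a = a) :
    a ∈ IntermediateField.fixedField (Subgroup.zpowers σ) := by
  rw [IntermediateField.mem_fixedField_iff]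
  exact fun τ hτ => (Subgroup.zpowers_le (H := MulAction.stabilizer (F ≃ₐ[k] F) a)).2 ha hτ

/-- Elements that are linearly independent over the fixed field of `σ` have a nonvanishing
Casorati determinant. -/
theorem eq_zero_of_sum_mul_pow_apply_eq_zero (σ : F ≃ₐ[k] F) (m : ℕ) (f : Fin m → F)
    (hf : LinearIndependent (IntermediateField.fixedField (Subgroup.zpowers σ)) f)
    (c : Fin m → F) (hc : ∀ j < m, ∑ i, c i * (σ ^ j) (f i) = 0) : c = 0 := by
  induction m with
  | zero => exact Subsingleton.elim _ _
  | succ m ih =>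
    have hf' : LinearIndependent (IntermediateField.fixedField (Subgroup.zpowers σ))
        (fun i : Fin m => f i.castSucc) := hf.comp _ (Fin.castSucc_injective m)
    by_cases hl : c (Fin.last m) = 0
    · have h1 := ih (fun i => f i.castSucc) hf' (fun i => c i.castSucc) fun j hj => by
        have h2 := hc j (by omega)
        rwa [Fin.sum_univ_castSucc, hl, zero_mul, add_zero] at h2
      funext i
      induction i using Fin.lastCases with
      | last => exact hl
      | cast i => exact congrFun h1 i
    · exfalso
      -- With last coefficient `1`, apply `σ⁻¹` to relation `j + 1` and subtract it from relation
      -- `j`: the last term cancels, and induction gives `σ d = d`. Relation `0` is then a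
      -- dependence over the fixed field.
      set d : Fin m → F := fun i => c i.castSucc / c (Fin.last m) with hd
      have hrel : ∀ j < m + 1, ∑ i, d i * (σ ^ j) (f i.castSucc) + (σ ^ j) (f (Fin.last m)) = 0 := by
        intro j hj
        have h2 := hc j hj
        rw [Fin.sum_univ_castSucc] at h2
        have h3 : ∑ i, d i * (σ ^ j) (f i.castSucc) =
            (∑ i : Fin m, c i.castSucc * (σ ^ j) (f i.castSucc)) / c (Fin.last m) := by
          rw [Finset.sum_div]
          exact Finset.sum_congr rfl fun i _ => by rw [hd]; ring
        rw [h3, eq_neg_of_add_eq_zero_left h2]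
        field_simp
        ring
      have h4 := ih (fun i => f i.castSucc) hf' (fun i => d i - σ.symm (d i)) fun j hj => by
        have h5 := congrArg σ.symm (hrel (j + 1) (by omega))
        have h6 : ∀ x, σ.symm ((σ ^ (j + 1)) x) = (σ ^ j) x := fun x => by
          rw [pow_succ', AlgEquiv.mul_apply, AlgEquiv.symm_apply_apply]
        simp only [map_add, map_sum, map_mul, map_zero, h6] at h5
        have h7 := hrel j (by omega)
        simp_rw [sub_mul, Finset.sum_sub_distrib]
        linear_combination h7 - h5
      have h8 : ∀ i, σ (d i) = d i := fun i => by
        have h9 : d i - σ.symm (d i) = 0 := congrFun h4 i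
        rw [sub_eq_zero] at h9
        conv_lhs => rw [h9, AlgEquiv.apply_symm_apply]
      have h10 := Fintype.linearIndependent_iff.1 hf
        (Fin.lastCases 1 fun i => ⟨d i, mem_fixedField_zpowers (h8 i)⟩) (by
          rw [Fin.sum_univ_castSucc]
          simp only [Fin.lastCases_last, Fin.lastCases_castSucc, one_smul]
          exact hrel 0 (by omega)) (Fin.last m)
      simp at h10

/-- The Casorati matrix of a family of functions with respect to `σ`. -/
def casoratiMatrix (σ : F ≃ₐ[k] F) {s : ℕ} (f : Fin s → F) : Matrix (Fin s) (Fin s) F :=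
  Matrix.of fun i j => (σ ^ (j : ℕ)) (f i)

theorem det_casoratiMatrix_ne_zero (σ : F ≃ₐ[k] F) {s : ℕ} {f : Fin s → F}
    (hf : LinearIndependent (IntermediateField.fixedField (Subgroup.zpowers σ)) f) :
    (casoratiMatrix σ f).det ≠ 0 := by
  intro h
  obtain ⟨c, hc0, hc⟩ := Matrix.exists_vecMul_eq_zero_iff.2 h
  exact hc0 (eq_zero_of_sum_mul_pow_apply_eq_zero σ s f hf c fun j hj => congrFun hc ⟨j, hj⟩)

/-- The change of basis has entries in `k`, fixed by `σ`, so one matrix transforms all columns.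
Vanishing orders may thus be computed in any basis. -/
theorem det_casoratiMatrix_basis (σ : F ≃ₐ[k] F) {s : ℕ} {V : Type*} [AddCommGroup V] [Module k V]
    (φ : V →ₗ[k] F) (b b' : Module.Basis (Fin s) k V) :
    ∃ a : k, a ≠ 0 ∧ (casoratiMatrix σ (φ ∘ b')).det =
      algebraMap k F a * (casoratiMatrix σ (φ ∘ b)).det := by
  refine ⟨b.det b', (b.isUnit_det b').ne_zero, ?_⟩
  have h1 : casoratiMatrix σ (φ ∘ b') =
      (b.toMatrix b').transpose.map (algebraMap k F) * casoratiMatrix σ (φ ∘ b) := by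
    ext i j
    simp only [casoratiMatrix, Matrix.of_apply, Matrix.mul_apply, Matrix.map_apply,
      Matrix.transpose_apply, Module.Basis.toMatrix_apply, Function.comp_apply]
    conv_lhs => rw [← b.sum_repr (b' i)]
    simp only [map_sum, map_smul, Algebra.smul_def, map_mul, AlgEquiv.commutes]
  rw [h1, Matrix.det_mul, Module.Basis.det_apply, ← RingHom.mapMatrix_apply, ← RingHom.map_det,
    Matrix.det_transpose]

theorem valuation_det_le {ι Γ : Type*} [Fintype ι] [DecidableEq ι]
    [LinearOrderedCommGroupWithZero Γ] (v : Valuation F Γ) (M : Matrix ι ι F) (r : ι → Γ)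
    (h : ∀ i j, v (M i j) ≤ r i) : v M.det ≤ ∏ i, r i := by
  rw [Matrix.det_apply]
  refine v.map_sum_le fun τ _ => ?_
  have h1 : v (Equiv.Perm.sign τ • ∏ i, M (τ i) i) = ∏ i, v (M (τ i) i) := by
    rcases Int.units_eq_one_or (Equiv.Perm.sign τ) with h | h <;> simp [h, Units.smul_def]
  rw [h1, ← Equiv.prod_comp τ r]
  exact Finset.prod_le_prod' fun i _ => h _ _

theorem exists_basis_adapted {V : Type*} [AddCommGroup V] [Module k V] [FiniteDimensional k V]
    {s : ℕ} (hs : Module.finrank k V = s) (U : Submodule k V) :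
    ∃ (b : Module.Basis (Fin s) k V) (T : Finset (Fin s)), T.card = Module.finrank k U ∧
      ∀ i ∈ T, b i ∈ U := by
  classical
  obtain ⟨C, hC⟩ := U.exists_isCompl
  let b₀ := ((Module.finBasis k U).prod (Module.finBasis k C)).map (U.prodEquivOfIsCompl C hC)
  have hcard : Fintype.card (Fin (Module.finrank k U) ⊕ Fin (Module.finrank k C)) = s := by
    rw [← hs, Module.finrank_eq_card_basis b₀]
  let e := Fintype.equivFinOfCardEq hcard
  refine ⟨b₀.reindex e, Finset.univ.map (Function.Embedding.inl.trans e.toEmbedding), by simp, ?_⟩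
  intro i hi
  obtain ⟨j, -, rfl⟩ := Finset.mem_map.1 hi
  simp [b₀]

/-! ### Conjugate places and invariant divisors -/

namespace Place

theorem conj_mul (σ τ : F ≃ₐ[k] F) (P : Place k F) : P.conj (σ * τ) = (P.conj τ).conj σ := rfl

theorem conj_one (P : Place k F) : P.conj 1 = P := rfl

theorem conj_injective (σ : F ≃ₐ[k] F) : Function.Injective (conj (k := k) σ) := by
  intro P R h
  have h1 := congrArg (conj σ⁻¹) h
  rwa [← conj_mul, ← conj_mul, inv_mul_cancel, conj_one, conj_one] at h1

theorem valuation_conj_inv (τ : F ≃ₐ[k] F) (P : Place k F) (f : F) :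
    (P.conj τ⁻¹).valuation f = P.valuation (τ f) := rfl

theorem degree_conj (τ : F ≃ₐ[k] F) (P : Place k F) : (P.conj τ).degree = P.degree := by
  let e : P.ring ≃+* (P.conj τ).ring :=
    { toFun := fun f => ⟨τ f, by
        rw [mem_ring_iff]
        change P.valuation (τ.symm (τ f)) ≤ 1
        rw [AlgEquiv.symm_apply_apply]
        exact (P.mem_ring_iff _).1 f.2⟩
      invFun := fun f => ⟨τ.symm f, (P.mem_ring_iff _).2 (((P.conj τ).mem_ring_iff _).1 f.2)⟩
      left_inv := fun f => Subtype.ext (τ.symm_apply_apply f)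
      right_inv := fun f => Subtype.ext (τ.apply_symm_apply f)
      map_mul' := fun f g => Subtype.ext (map_mul τ _ _)
      map_add' := fun f g => Subtype.ext (map_add τ _ _) }
  have he : ∀ a : k, e (algebraMap k P.ring a) = algebraMap k (P.conj τ).ring a := fun a =>
    Subtype.ext (τ.commutes a)
  let E : P.ResidueField ≃+* (P.conj τ).ResidueField := IsLocalRing.ResidueField.mapEquiv e
  have hE : ∀ (a : k) (x : P.ResidueField), E (a • x) = a • E x := by
    intro a x
    rw [Algebra.smul_def, Algebra.smul_def, map_mul]
    congr 1
    rw [IsScalarTower.algebraMap_apply k P.ring P.ResidueField,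
      IsScalarTower.algebraMap_apply k (P.conj τ).ring (P.conj τ).ResidueField,
      IsLocalRing.ResidueField.algebraMap_eq, IsLocalRing.ResidueField.algebraMap_eq, ← he]
    rfl
  exact (LinearEquiv.finrank_eq (M := P.ResidueField) (N := (P.conj τ).ResidueField)
    { E with map_smul' := hE }).symm

theorem injOn_conj_of_ncard_orbitSegment {σ : F ≃ₐ[k] F} {t : ℕ} {P : Place k F}
    (h : (P.orbitSegment σ t).ncard = t) :
    Set.InjOn (fun i : ℕ => P.conj (σ ^ i)⁻¹) (Set.Iio t) := by
  have h1 : P.orbitSegment σ t = (fun i : ℕ => P.conj (σ ^ i)⁻¹) '' Set.Iio t := by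
    ext R
    constructor
    · rintro ⟨i, hi, rfl⟩
      exact ⟨i, hi, rfl⟩
    · rintro ⟨i, hi, rfl⟩
      exact ⟨i, hi, rfl⟩
  rw [h1] at h
  refine (Set.ncard_image_iff (Set.finite_Iio t)).1 ?_
  rw [h, Set.ncard_eq_toFinset_card']
  simp

end Place

namespace Divisor

theorem apply_conj_pow_inv {D : Divisor k F} {σ : F ≃ₐ[k] F} (hD : D.conj σ = D) (n : ℕ)
    (P : Place k F) : D (P.conj (σ ^ n)⁻¹) = D P := by
  have h1 : ∀ R : Place k F, D (R.conj σ) = D R := fun R => by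
    conv_lhs => rw [← hD]
    exact Finsupp.mapDomain_apply (Place.conj_injective σ) D R
  have h2 : ∀ (n : ℕ) (R : Place k F), D (R.conj (σ ^ n)) = D R := by
    intro n
    induction n with
    | zero => intro R; rw [pow_zero, Place.conj_one]
    | succ n ih => intro R; rw [pow_succ, Place.conj_mul, ih, h1]
  rw [← h2 n, ← Place.conj_mul, mul_inv_cancel, Place.conj_one]

theorem riemannRoch_eq_boundedSpace {D : Divisor k F} {e : Place k F →₀ ℕ}
    (he : ∀ P, (e P : ℤ) = D P) :
    D.riemannRoch = boundedSpace (Set.univ : Set (Place k F)) fun P => (e P : ℤ) := by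
  ext f
  simp only [mem_boundedSpace, Set.mem_univ, forall_const, he]
  rfl

end Divisor

/-! ### Counting the zeros of the Casorati determinant -/

/-- A nonzero function in the Riemann-Roch space of an effective divisor `e` has at most `deg e`
zeros at distinct places `R i`, counted with multiplicity and degree. -/
theorem IsFunctionField.sum_mul_degree_le (hF : IsFunctionField k F)
    (hk : IsFullConstantField k F) {g : F} (hg0 : g ≠ 0) (e : Place k F →₀ ℕ)
    (hge : g ∈ boundedSpace (Set.univ : Set (Place k F)) fun P => (e P : ℤ))
    {ι : Type*} [Fintype ι] (R : ι → Place k F) (hR : Function.Injective R) (m : ι → ℕ)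
    (hm : ∀ i, (R i).valuation g ≤ WithZero.exp (-(m i : ℤ))) :
    ∑ i, m i * (R i).degree ≤ e.sum fun P m => m * P.degree := by
  classical
  set z : Place k F →₀ ℕ := ∑ i, Finsupp.single (R i) (m i) with hz
  have hzR : ∀ i, z (R i) = m i := fun i => by
    rw [hz, Finsupp.finsetSum_apply, Finset.sum_eq_single i]
    · simp
    · intro j _ hj
      exact Finsupp.single_eq_of_ne (fun h => hj (hR h).symm)
    · simp
  have h1 := hF.sum_zeros_le_degree hk hg0 e hge z fun P hP => by
    obtain ⟨i, -, hi⟩ := Finsupp.mem_support_finsetSum P hP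
    have hPi : P = R i := by
      simpa using Finsupp.support_single_subset hi
    rw [hPi, hzR]
    exact hm i
  rw [hz, ← Finsupp.sum_finsetSum_index (by simp) (by intros; ring)] at h1
  simpa using h1

/-- `I_P` is the kernel of evaluation at `t` conjugates of `P`, each with residue field of dimension
`deg P`; they avoid `D` because `D` is invariant. -/
theorem finrank_quotient_vanishingSubspace_le (hF : IsFunctionField k F) {D : Divisor k F}
    {σ : F ≃ₐ[k] F} (hDσ : D.conj σ = D) {P : Place k F} (hP : P ∉ D.support) (t : ℕ) :
    Module.finrank k (D.riemannRoch ⧸ D.vanishingSubspace σ t P) ≤ P.degree * t := by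
  have hreg : ∀ (i : ℕ), ∀ f ∈ D.riemannRoch, (P.conj (σ ^ i)⁻¹).valuation (f / 1) ≤ 1 := by
    intro i f hf
    have h1 := hf (P.conj (σ ^ i)⁻¹)
    rw [Divisor.apply_conj_pow_inv hDσ, Finsupp.notMem_support_iff.1 hP] at h1
    simpa using h1
  have hfin := fun R : Place k F => hF.finite_residueField R
  let φ : D.riemannRoch →ₗ[k] (∀ i : Fin t, (P.conj (σ ^ (i : ℕ))⁻¹).ResidueField) :=
    LinearMap.pi fun i => (P.conj (σ ^ (i : ℕ))⁻¹).leadingCoeff 1 D.riemannRoch (hreg i)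
  have hker : LinearMap.ker φ = D.vanishingSubspace σ t P := by
    ext f
    rw [LinearMap.mem_ker, funext_iff]
    constructor
    · intro h i hi
      have h1 := (Place.leadingCoeff_eq_zero_iff (hB := hreg i) _ f).1 (h ⟨i, hi⟩)
      rwa [div_one] at h1
    · intro h i
      refine (Place.leadingCoeff_eq_zero_iff (hB := hreg i) _ f).2 ?_
      rw [div_one]
      exact h i i.2
  rw [← hker]
  refine (LinearMap.finrank_le_finrank_of_injective
    (LinearMap.ker_eq_bot.1 ((LinearMap.ker φ).ker_liftQ_eq_bot φ le_rfl le_rfl))).trans ?_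
  rw [Module.finrank_pi_fintype]
  change ∑ i : Fin t, (P.conj (σ ^ (i : ℕ))⁻¹).degree ≤ _
  simp_rw [Place.degree_conj]
  simp [mul_comm]

/-- The vanishing orders of the Casorati determinant of a basis of `V`. -/
theorem valuation_det_casoratiMatrix_le {σ : F ≃ₐ[k] F} {s : ℕ} {V : Type*} [AddCommGroup V]
    [Module k V] (φ : V →ₗ[k] F) (b : Module.Basis (Fin s) k V) (U : Submodule k V)
    (R : Place k F) (hreg : ∀ v, ∀ j < s, R.valuation ((σ ^ j) (φ v)) ≤ 1)
    (hU : ∀ v ∈ U, ∀ j < s, R.valuation ((σ ^ j) (φ v)) < 1) :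
    R.valuation (casoratiMatrix σ (φ ∘ b)).det ≤
      WithZero.exp (-(Module.finrank k U : ℤ)) := by
  classical
  have hfin : FiniteDimensional k V := Module.Basis.finiteDimensional_of_finite b
  obtain ⟨b', T, hT, hb'⟩ := exists_basis_adapted (s := s)
    (by rw [Module.finrank_eq_card_basis b, Fintype.card_fin]) U
  obtain ⟨a, ha, hdet⟩ := det_casoratiMatrix_basis σ φ b b'
  have h1 : R.valuation (casoratiMatrix σ (φ ∘ b)).det =
      R.valuation (casoratiMatrix σ (φ ∘ b')).det := by
    rw [hdet, map_mul, R.valuation_algebraMap ha, one_mul]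
  rw [h1]
  refine (valuation_det_le R.valuation _
    (fun i => if i ∈ T then WithZero.exp (-1) else 1) fun i j => ?_).trans ?_
  · split_ifs with hi
    · have h2 := hU _ (hb' i hi) j j.2
      rw [← WithZero.exp_zero, lt_exp_iff] at h2
      exact h2
    · exact hreg _ j j.2
  · rw [Finset.prod_ite_mem, Finset.univ_inter, Finset.prod_const, hT, ← WithZero.exp_nsmul,
      WithZero.exp_le_exp]
    simp

theorem valuation_det_casoratiMatrix_le_pow {σ : F ≃ₐ[k] F} {s : ℕ} {f : Fin s → F}
    (R : Place k F) {c : ℤᵐ⁰} (hc : ∀ i (j : ℕ), R.valuation ((σ ^ j) (f i)) ≤ c) :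
    R.valuation (casoratiMatrix σ f).det ≤ c ^ s := by
  have h := valuation_det_le R.valuation (casoratiMatrix σ f) (fun _ => c) fun i j => hc i j
  rwa [Finset.prod_const, Finset.card_univ, Fintype.card_fin] at h

theorem sum_finrank_mul_le (hF : IsFunctionField k F) (hk : IsFullConstantField k F)
    {σ : F ≃ₐ[k] F} (hσ : IsOfFinOrder σ)
    {Q : Place k (IntermediateField.fixedField (Subgroup.zpowers σ))} (hQ : Q.degree = 1)
    {Q' : Place k F} (hQ' : Q'.LiesAbove Q) (hQ'_unique : ∀ P : Place k F, P.LiesAbove Q → P = Q')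
    {D : Divisor k F} (hDQ' : Q' ∉ D.support) (hDσ : D.conj σ = D)
    {e : Place k F →₀ ℕ} (he : ∀ P, (e P : ℤ) = D P)
    (hdeg : (e.sum fun P m => m * P.degree) <
      Module.finrank (IntermediateField.fixedField (Subgroup.zpowers σ)) F)
    {r s t : ℕ} (hst : s ≤ t)
    {ℱ : Set (Place k F)} [Fintype ℱ] (hℱD : ∀ P ∈ ℱ, P ∉ D.support)
    (hℱr : ∀ P ∈ ℱ, P.degree = r)
    (hℱt : ∀ P ∈ ℱ, (P.orbitSegment σ t).ncard = t)
    (hℱ : ℱ.PairwiseDisjoint fun P => P.orbitSegment σ t)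
    (hs : 1 ≤ s) {V : Type*} [AddCommGroup V] [Module k V] (b : Module.Basis (Fin s) k V) {φ : V →ₗ[k] F}
    (hφ : Function.Injective φ)
    (hmem : ∀ w, φ w ∈ boundedSpace (Set.univ : Set (Place k F)) fun P => (e P : ℤ))
    (U : ℱ → Submodule k V)
    (hU : ∀ P, ∀ v ∈ U P, ∀ i < t, ((P : Place k F).conj (σ ^ i)⁻¹).Vanishes (φ v)) :
    (∑ P : ℱ, Module.finrank k (U P)) * (r * (t - s + 1)) ≤
      s * e.sum fun P m => m * P.degree := by
  obtain ⟨d, hd⟩ : ∃ d : ℱ → ℕ, ∀ P, d P = Module.finrank k (U P) := ⟨_, fun _ => rfl⟩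
  simp_rw [← hd]
  have hgal := isGalois_fixedField_zpowers hσ
  have hfin : FiniteDimensional (IntermediateField.fixedField (Subgroup.zpowers σ)) F :=
    Module.finite_of_finrank_pos (by omega)
  have hval : ∀ (R : Place k F) (w : V) (j : ℕ),
      R.valuation ((σ ^ j) (φ w)) ≤ WithZero.exp (e R : ℤ) := by
    intro R w j
    have h1 := hmem w (R.conj (σ ^ j)⁻¹) trivial
    rw [Place.valuation_conj_inv] at h1
    beta_reduce at h1
    rwa [he, Divisor.apply_conj_pow_inv hDσ, ← he] at h1
  have hbk : LinearIndependent k (φ ∘ b) :=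
    b.linearIndependent.map' φ (LinearMap.ker_eq_bot.2 hφ)
  have heQ' : e Q' = 0 := by
    have := he Q'
    rw [Finsupp.notMem_support_iff.1 hDQ'] at this
    exact_mod_cast this
  have hlin : LinearIndependent (IntermediateField.fixedField (Subgroup.zpowers σ)) (φ ∘ b) :=
    Place.LiesAbove.linearIndependent_of_boundedSpace hF hk hQ' hQ'_unique hQ heQ' hdeg
      (fun i => hmem (b i)) hbk
  set Δ := (casoratiMatrix σ (φ ∘ b)).det with hΔ
  have hΔ0 : Δ ≠ 0 := det_casoratiMatrix_ne_zero σ hlin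
  have hΔmem : Δ ∈ boundedSpace (Set.univ : Set (Place k F))
      fun P => (((s • e : Place k F →₀ ℕ) P : ℕ) : ℤ) := by
    intro R _
    refine (valuation_det_casoratiMatrix_le_pow (f := φ ∘ b) R fun i j => hval R (b i) j).trans ?_
    rw [← WithZero.exp_nsmul, WithZero.exp_le_exp]
    simp
  -- Only shifts `i ≤ t - s` are used, so that `i + j < t` for every column `j < s`.
  have hinj : Function.Injective fun p : ℱ × Fin (t - s + 1) =>
      (p.1 : Place k F).conj (σ ^ (p.2 : ℕ))⁻¹ := by
    rintro ⟨P, i⟩ ⟨R, j⟩ h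
    have hi : (i : ℕ) < t := by omega
    have hj : (j : ℕ) < t := by omega
    have hPR : P = R := by
      by_contra hne
      have h1 := hℱ P.2 R.2 (fun h => hne (Subtype.ext h))
      exact Set.disjoint_left.1 h1 ⟨i, hi, rfl⟩ ⟨j, hj, h⟩
    subst hPR
    have hij := Place.injOn_conj_of_ncard_orbitSegment (hℱt P P.2) hi hj h
    exact Prod.ext rfl (Fin.ext hij)
  have hmain := hF.sum_mul_degree_le hk hΔ0 (s • e) hΔmem _ hinj
    (fun p => d p.1) (by
      rintro ⟨P, i⟩
      rw [hd]
      refine valuation_det_casoratiMatrix_le φ b (U P) _ (fun v j _ => ?_) fun v hv j hj => ?_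
      · have h1 := hval ((P : Place k F).conj (σ ^ (i : ℕ))⁻¹) v j
        rw [he, Divisor.apply_conj_pow_inv hDσ, Finsupp.notMem_support_iff.1 (hℱD P P.2)] at h1
        simpa using h1
      · have h1 : ((P : Place k F).conj (σ ^ (i + j : ℕ))⁻¹).valuation (φ v) < 1 :=
          hU P v hv (i + j) (by omega)
        rw [Place.valuation_conj_inv, pow_add] at h1
        exact h1)
  simp only [Place.degree_conj] at hmain
  rw [Fintype.sum_prod_type, Finsupp.sum_smul_index (by simp)] at hmain
  simp only [mul_assoc, ← Finsupp.mul_sum] at hmain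
  refine le_trans (le_of_eq ?_) hmain
  rw [Finset.sum_mul]
  refine Finset.sum_congr rfl fun P _ => ?_
  rw [Finset.sum_const, Finset.card_univ, Fintype.card_fin, hℱr P P.2, smul_eq_mul]
  ring

end FnField

/-! ### The strong subspace design -/

open FnField in
theorem theorem3p7 {k F : Type*} [Field k] [Finite k] [Field F] [Algebra k F]
    (hF : IsFunctionField k F) (hk : IsFullConstantField k F)
    -- an automorphism of finite order, with fixed field `F^σ`
    (σ : F ≃ₐ[k] F) (hσ : IsOfFinOrder σ)
    -- a rational place of `F^σ` with exactly one place of `F` above it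
    (Q : Place k (IntermediateField.fixedField (Subgroup.zpowers σ))) (hQ : Q.degree = 1)
    (Q' : Place k F) (hQ' : Q'.LiesAbove Q) (hQ'_unique : ∀ P : Place k F, P.LiesAbove Q → P = Q')
    -- a `σ`-invariant positive divisor of small degree, whose support does not contain `Q'`
    (D : Divisor k F) (hD : 0 ≤ D) (hDQ' : Q' ∉ D.support) (hDσ : D.conj σ = D)
    (hDdeg : D.degree <
      (Module.finrank (IntermediateField.fixedField (Subgroup.zpowers σ)) F : ℤ))
    (r s t : ℕ) (hs : 1 ≤ s) (hst : s ≤ t)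
    -- the set of places of degree `r` indexing the subspaces
    (ℱ : Set (Place k F)) (hℱD : ∀ P ∈ ℱ, P ∉ D.support) (hℱr : ∀ P ∈ ℱ, P.degree = r)
    (hℱt : ∀ P ∈ ℱ, (P.orbitSegment σ t).ncard = t)
    (hℱ : ℱ.PairwiseDisjoint fun P => P.orbitSegment σ t) :
    (∀ P ∈ ℱ, Module.finrank k (D.riemannRoch ⧸ D.vanishingSubspace σ t P) ≤ r * t) ∧
    IsStrongSubspaceDesign (fun P : ℱ => D.vanishingSubspace σ t P) s
      ((D.degree : ℝ) * s / (r * ((t : ℝ) - s + 1))) := by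
  refine ⟨fun P hP => hℱr P hP ▸ finrank_quotient_vanishingSubspace_le hF hDσ (hℱD P hP) t, ?_⟩
  have hfin : Finite ℱ := ((hF.finite_setOf_degree_eq r).subset hℱr).to_subtype
  let e : Place k F →₀ ℕ := D.mapRange Int.toNat rfl
  have he : ∀ P, (e P : ℤ) = D P := fun P => by
    rw [Finsupp.mapRange_apply]
    exact Int.toNat_of_nonneg (hD P)
  have hdeg : ((e.sum fun P m => m * P.degree : ℕ) : ℤ) = D.degree := by
    rw [Divisor.degree, Finsupp.sum_mapRange_index (by simp), Finsupp.sum, Finsupp.sum,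
      Nat.cast_sum]
    refine Finset.sum_congr rfl fun P _ => ?_
    rw [Nat.cast_mul, Int.toNat_of_nonneg (hD P)]
  refine ⟨hfin, ?_, fun W hW => ?_⟩
  · rw [Divisor.riemannRoch_eq_boundedSpace he]
    exact finite_of_length_ne_top (ne_top_of_le_ne_top (ENat.natCast_ne_top _)
      (hF.length_boundedSpace_le hk e))
  have := Fintype.ofFinite ℱ
  have hWfree : Module.Free k W := Module.Free.of_divisionRing k W
  have hWfin : Module.Finite k W := Module.finite_of_finrank_pos (by omega)
  obtain ⟨b⟩ : Nonempty (Module.Basis (Fin s) k W) := ⟨Module.finBasisOfFinrankEq k W hW⟩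
  have hdim : ∀ P : ℱ, Module.finrank k ↥(W ⊓ D.vanishingSubspace σ t P) =
      Module.finrank k ((D.vanishingSubspace σ t P).comap W.subtype) := fun P => by
    rw [← Submodule.map_comap_subtype, Submodule.finrank_map_subtype_eq]
  let φ : W →ₗ[k] F := D.riemannRoch.subtype ∘ₗ W.subtype
  have hmem : ∀ w, φ w ∈ boundedSpace (Set.univ : Set (Place k F)) fun P => (e P : ℤ) := fun w =>
    (Divisor.riemannRoch_eq_boundedSpace he).le (w : D.riemannRoch).2
  have hφ : Function.Injective φ := Subtype.val_injective.comp Subtype.val_injective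
  let U : ℱ → Submodule k W := fun P => (D.vanishingSubspace σ t P).comap W.subtype
  have hU : ∀ P, ∀ v ∈ U P, ∀ i < t, ((P : Place k F).conj (σ ^ i)⁻¹).Vanishes (φ v) :=
    fun P v hv => hv
  have hmain := sum_finrank_mul_le hF hk hσ hQ hQ' hQ'_unique hDQ' hDσ he
    (by rw [← hdeg] at hDdeg; exact_mod_cast hDdeg) hst hℱD hℱr hℱt hℱ hs (V := W) b
    (φ := φ) hφ
    hmem U hU
  rw [finsum_eq_sum_of_fintype]
  simp_rw [hdim]
  have hts : (1 : ℝ) ≤ (t : ℝ) - s + 1 := by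
    have : (s : ℝ) ≤ t := by exact_mod_cast hst
    linarith
  have hdegR : ((e.sum fun P m => m * P.degree : ℕ) : ℝ) = D.degree := by
    rw [← hdeg, Int.cast_natCast]
  -- A member of `ℱ` forces `r > 0`; without one, `r` may be `0` and only nonnegativity of the bound
  -- is needed.
  rcases isEmpty_or_nonempty ℱ with hemp | ⟨⟨P⟩⟩
  · rw [Finset.univ_eq_empty, Finset.sum_empty, ← hdegR]
    positivity
  · have hr : (0 : ℝ) < r := by
      have := hF.degree_pos (P : Place k F)
      rw [hℱr P P.2] at this
      exact_mod_cast this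
    rw [le_div_iff₀ (by positivity), ← hdegR]
    have h1 : ((∑ P : ℱ, Module.finrank k ((D.vanishingSubspace σ t P).comap W.subtype) : ℕ) : ℝ) *
        (r * ((t - s : ℕ) + 1)) ≤ s * (e.sum fun P m => m * P.degree : ℕ) := by
      exact_mod_cast hmain
    rw [Nat.cast_sub hst, Nat.cast_sum] at h1
    linarith
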